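/- Let $d\ge 1$ be an integer and $\alpha\ge 1$ a real number. For $N\ge 1$ let $\mathbb{T}^d_N=\{0,\frac1N,\dots,\frac{N-1}{N}\}^d$ be the discrete torus, write $x\sim y$ for nearest neighbours, and let $\chi_N>0$ be the particle size. The rescaled zero-range process $\eta^N_\bullet$ is the càdlàg Markov process with values in $X_N=(\chi_N\mathbb{N})^{\mathbb{T}^d_N}$ (where $0\in\mathbb N$) and generator $N^2\mathcal{L}_N$, $$\mathcal{L}_NF(\eta)=\frac12\sum_{x\sim y}\frac{\eta(x)^\alpha}{\chi_N}\left(F(\eta+\chi_N1_y-\chi_N1_x)-F(\eta)\right),$$ the sum being over ordered pairs of neighbours. For $a>0$ let $\Pi^N_a$ be the equilibrium distribution $$\Pi^N_a(\eta)=\prod_{x\in\mathbb{T}^d_N}\frac{(a/\chi_N)^{\alpha\,\eta(x)/\chi_N}}{((\eta(x)/\chi_N)!)^\alpha\,Z_\alpha(a/\chi_N)},\qquad Z_\alpha(u)=\sum_{j\ge0}\frac{u^{\alpha j}}{(j!)^\alpha},$$ and write $\mathbb{E}_{\Pi^N_a}$ for the expectation when $\eta^N_0$ has distribution $\Pi^N_a$.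 For $b>0$ let $X_{N,b}=\{\eta\in X_N:\ N^{-d}\sum_x\eta(x)\le b\}$. A strict Young function is a convex, even, lower semicontinuous function $\Phi:\mathbb{R}\to[0,\infty)$ with $\Phi(0)=0$ and $\Phi(u)/u\to\infty$ as $u\to\infty$, and for $h:\mathbb{T}^d_N\to\mathbb{R}$ $$\|h\|_{\ell_\Phi}=\inf\Big\{t>0:\ \frac1{N^d}\sum_{x\in\mathbb{T}^d_N}\Phi\big(h(x)/t\big)\le1\Big\}.$$ **Theorem.** Let $(\chi_N)_{N\ge1}$ be any sequence of positive numbers with $\chi_N\to0$. Then there exist a constant $\beta>0$ and a strict Young function $\Phi$, depending only on the sequence $(\chi_N)$ (and on $d$ and $\alpha$), such that for all $a,b>0$ and all $t_{\mathrm{fin}}\in(0,\infty)$ $$\limsup_{N\to\infty}\frac{\chi_N}{N^d}\log\mathbb{E}_{\Pi^N_a}\left[\exp\left(\frac{\beta N^d}{\chi_N}\int_0^{t_{\mathrm{fin}}}\|(\eta^N_s)^\alpha\|_{\ell_\Phi}\,1(\eta^N_s\in X_{N,b})\,ds\right)\right]<\infty.$$ -/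

import Mathlib

open Filter Topology MeasureTheory

noncomputable section

namespace ZeroRange

/-- The discrete torus with `N` sites in each of the `d` directions. The site `z` stands for the
point `z / N` of the rescaled torus `{0, 1/N, …, (N-1)/N}^d`. -/
abbrev Site (d N : ℕ) : Type := Fin d → ZMod N

/-- Configurations, given by the number of particles at each site. With particle size `c`, the
configuration `k` stands for the element `η = c k` of `(c ℕ)^(torus)`. -/
abbrev Config (d N : ℕ) : Type := Site d N → ℕ

variable {d N : ℕ}

/-- The value `η(x) = c k(x)`, where `c` is the particle size. -/
def density (c : ℝ) (k : Config d N) (x : Site d N) : ℝ := c * (k x : ℝ)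

/-- Nearest neighbours in the discrete torus. -/
def Adj (x y : Site d N) : Prop :=
  x ≠ y ∧ ∃ i : Fin d, y = x + Pi.single i 1 ∨ x = y + Pi.single i 1

/-- The configuration after one particle has moved from `x` to `y`. It is only used with a
prefactor that vanishes if there is no particle at `x`. -/
def move (k : Config d N) (x y : Site d N) : Config d N :=
  k - Pi.single x 1 + Pi.single y 1

open Classical in
/-- The generator `N² 𝓛`, where
`𝓛 F(η) = 1/2 ∑_{x ∼ y} η(x)^α / c * (F(η^{x,y}) - F(η))`
and the sum is over ordered pairs of neighbours. -/
def gen [NeZero N] (α c : ℝ) (F : Config d N → ℝ) (k : Config d N) : ℝ :=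
  (N : ℝ) ^ 2 * ((1 / 2) * ∑ x : Site d N, ∑ y : Site d N,
    if Adj x y then density c k x ^ α / c * (F (move k x y) - F k) else 0)

/-- Iterates of the generator grow at most exponentially on configurations with `m` particles. -/
lemma abs_gen_iterate_le [NeZero N] {α c : ℝ} (hα : 0 < α) (hc : 0 < c) (m : ℕ) :
    ∃ C : ℝ, ∀ (F : Config d N → ℝ) (M : ℝ), (∀ k, |F k| ≤ M) →
      ∀ (n : ℕ) (k : Config d N), ∑ x, k x = m → |((gen α c)^[n] F) k| ≤ C ^ n * M := by
  classical
  set R : ℝ := (c * m) ^ α / c with hR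
  have hR0 : 0 ≤ R := by positivity
  set C : ℝ := (N : ℝ) ^ 2 * ((1 / 2) * ∑ _x : Site d N, ∑ _y : Site d N, R * 2) with hC
  refine ⟨C, fun F M hF n => ?_⟩
  induction n with
  | zero => intro k _; simpa using hF k
  | succ n ih =>
    intro k hk
    have hM : 0 ≤ C ^ n * M := le_trans (abs_nonneg _) (ih k hk)
    rw [Function.iterate_succ_apply']
    generalize hB : C ^ n * M = B at ih hM
    have hCB : C ^ (n + 1) * M =
        (N : ℝ) ^ 2 * ((1 / 2) * ∑ _x : Site d N, ∑ _y : Site d N, R * (2 * B)) := by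
      rw [pow_succ, mul_right_comm, hB, hC]
      simp only [Finset.sum_const, nsmul_eq_mul]
      ring
    rw [hCB, gen, abs_mul, abs_mul, abs_of_nonneg (by positivity : (0 : ℝ) ≤ (N : ℝ) ^ 2),
      abs_of_nonneg (by norm_num : (0 : ℝ) ≤ 1 / 2)]
    gcongr
    refine (Finset.abs_sum_le_sum_abs _ _).trans (Finset.sum_le_sum fun x _ => ?_)
    refine (Finset.abs_sum_le_sum_abs _ _).trans (Finset.sum_le_sum fun y _ => ?_)
    split_ifs with hxy
    · rcases Nat.eq_zero_or_pos (k x) with h0 | hpos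
      · have : density c k x ^ α / c = 0 := by simp [density, h0, Real.zero_rpow hα.ne']
        rw [this, zero_mul, abs_zero]
        positivity
      · have hle : Pi.single x 1 ≤ k := by
          intro z
          by_cases hz : z = x
          · subst hz; simpa using Nat.succ_le_of_lt hpos
          · simp [hz]
        have hmass : ∑ z, move k x y z = m := by
          have h1 : ∑ z, (k - Pi.single x 1 : Config d N) z + ∑ z, (Pi.single x 1 : Config d N) z
              = ∑ z, k z := by
            rw [← Finset.sum_add_distrib]
            exact Finset.sum_congr rfl fun z _ => Nat.sub_add_cancel (hle z)
          have h2 : ∑ z, (Pi.single x 1 : Config d N) z = 1 := by simp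
          have h3 : ∑ z, (Pi.single y 1 : Config d N) z = 1 := by simp
          simp only [move, Pi.add_apply, Finset.sum_add_distrib]
          omega
        have hkx : k x ≤ m := hk ▸ Finset.single_le_sum (fun z _ => Nat.zero_le (k z))
          (Finset.mem_univ x)
        have hd0 : 0 ≤ density c k x := by unfold density; positivity
        rw [abs_mul, abs_of_nonneg (by positivity)]
        have h1 : density c k x ^ α / c ≤ R := by
          rw [hR]
          have : density c k x ≤ c * m := by
            unfold density
            gcongr
          gcongr
        have h2 := (abs_sub ((gen α c)^[n] F (move k x y)) ((gen α c)^[n] F k)).trans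
          (add_le_add (ih _ hmass) (ih k hk))
        refine mul_le_mul h1 (by linarith) (abs_nonneg _) hR0
    · rw [abs_zero]
      positivity

/-- The series that defines the transition probabilities converges. -/
lemma summable_transition [NeZero N] {α c : ℝ} (hα : 0 < α) (hc : 0 < c) (t : ℝ)
    (F : Config d N → ℝ) (M : ℝ) (hF : ∀ k, |F k| ≤ M) (k : Config d N) :
    Summable fun n : ℕ => t ^ n / (n.factorial : ℝ) * ((gen α c)^[n] F) k := by
  obtain ⟨C, hC⟩ := abs_gen_iterate_le (d := d) (N := N) hα hc (∑ x, k x)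
  refine Summable.of_norm_bounded
    (g := fun n : ℕ => (|t| * C) ^ n / (n.factorial : ℝ) * M)
    ((Real.summable_pow_div_factorial _).mul_right M) fun n => ?_
  rw [Real.norm_eq_abs, abs_mul, abs_div, abs_pow, Nat.abs_cast, mul_pow]
  calc |t| ^ n / (n.factorial : ℝ) * |((gen α c)^[n] F) k|
      ≤ |t| ^ n / (n.factorial : ℝ) * (C ^ n * M) := by
        gcongr
        exact hC F M hF n k rfl
    _ = |t| ^ n * C ^ n / (n.factorial : ℝ) * M := by ring

open Classical in
/-- The transition probability `(e^{tG} 1_l)(k)` from `k` to `l` in time `t`, where `G` is the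
generator. Particles are conserved, so `G` acts on the functions on the finite set of
configurations with a given number of particles, and the exponential series converges
(see `summable_transition`). -/
def transition [NeZero N] (α c t : ℝ) (k l : Config d N) : ℝ :=
  ∑' n : ℕ, t ^ n / (n.factorial : ℝ) *
    ((gen α c)^[n] (fun k' : Config d N => if k' = l then 1 else 0)) k

/-- The normalising constant `Z_α(u) = ∑_j u^{α j} / (j!)^α`. -/
def partitionFn (α u : ℝ) : ℝ :=
  ∑' j : ℕ, u ^ (α * (j : ℝ)) / (j.factorial : ℝ) ^ α

/-- The mass function of the equilibrium distribution `Π_a` for particle size `c`. -/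
def equilibrium [NeZero N] (α c a : ℝ) (k : Config d N) : ℝ :=
  ∏ x : Site d N, (a / c) ^ (α * (k x : ℝ)) /
    (((k x).factorial : ℝ) ^ α * partitionFn α (a / c))

/-- `K` is (the particle number representation of) a rescaled zero-range process on the time
interval `[0, T]`, with initial distribution given by the mass function `μ₀`: a process with
càdlàg paths in the discrete set of configurations, whose finite-dimensional distributions are
those of the Markov process with generator `gen α c`. The rescaled process is
`η_t(x) = density c (K t ω) x`. -/
structure IsRescaledZRP [NeZero N] (α c T : ℝ) (μ₀ : Config d N → ℝ)
    {Ω : Type*} [MeasurableSpace Ω] (P : Measure Ω) (K : ℝ → Ω → Config d N) : Prop where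
  measurable : ∀ t ∈ Set.Icc 0 T, Measurable (K t)
  right_continuous : ∀ᵐ ω ∂P, ∀ t ∈ Set.Ico 0 T, ∀ᶠ s in 𝓝[>] t, K s ω = K t ω
  left_limits : ∀ᵐ ω ∂P, ∀ t ∈ Set.Ioc 0 T, ∃ l, ∀ᶠ s in 𝓝[<] t, K s ω = l
  finite_dim : ∀ (n : ℕ) (t : ℕ → ℝ) (k : ℕ → Config d N),
    t 0 = 0 → Monotone t → t n ≤ T →
    P {ω | ∀ i ≤ n, K (t i) ω = k i} =
      ENNReal.ofReal (μ₀ (k 0) *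
        ∏ i ∈ Finset.range n, transition α c (t (i + 1) - t i) (k i) (k (i + 1)))

/-- The set of configurations with `N^{-d} ∑_x η(x) ≤ b`. -/
def massBounded [NeZero N] (c b : ℝ) : Set (Config d N) :=
  {k | 1 / (N : ℝ) ^ d * ∑ x : Site d N, density c k x ≤ b}

/-- Strict Young functions: even, convex, lower semicontinuous, with values in `[0, ∞)`, vanishing
at `0`, and growing faster than linearly. -/
structure IsStrictYoung (Φ : ℝ → ℝ) : Prop where
  nonneg : ∀ u, 0 ≤ Φ u
  convex : ConvexOn ℝ Set.univ Φ
  even : ∀ u, Φ (-u) = Φ u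
  lsc : LowerSemicontinuous Φ
  zero : Φ 0 = 0
  superlinear : Tendsto (fun u => Φ u / u) atTop atTop

/-- The Orlicz norm of `h` with respect to the uniform probability on the discrete torus. -/
def orliczNorm [NeZero N] (Φ : ℝ → ℝ) (h : Site d N → ℝ) : ℝ :=
  sInf {t : ℝ | 0 < t ∧ 1 / (N : ℝ) ^ d * ∑ x : Site d N, Φ (h x / t) ≤ 1}

open Classical in
/-- The quantity `‖η^α‖_{ℓ_Φ} 1(η ∈ X_{N,b})`. -/
def truncatedNorm [NeZero N] (α c b : ℝ) (Φ : ℝ → ℝ) (k : Config d N) : ℝ :=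
  if k ∈ massBounded c b then orliczNorm Φ (fun x => density c k x ^ α) else 0

end ZeroRange

end

/-! By a Feynman–Kac bound, the exponential moment is controlled by `exp (T * (L + 1))`, where `L`
bounds the quadratic form of the generator perturbed by `N ^ d / c` times the truncated norm. The
theorem therefore reduces to `L = O(N ^ d / c)`, uniformly in `N`. Mass is conserved and the
potential vanishes above mass `b * N ^ d`, so only finitely many configurations matter.

The spectral bound is a gain of integrability from the Dirichlet form. Removing a marked particle at
`x` turns the equilibrium weight times `η(x)^α` into `a ^ α` times the weight of the remaining
configuration `z` (`equilibrium_add_single`). Hence the Dirichlet form is an average over `z` of the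
energies of the functions `x ↦ f (z + 1_x)` on the torus, and each moment `∑ η(x)^α G(η(x))` against
`f ^ 2` becomes a weighted square sum of the same functions. For one such function, the energy times
`l ^ 2` controls the sites where the density exceeds its averages over blocks of side `l`
(`block_energy_bound`).

With total mass at most `b * N ^ d`, averages over blocks of side about `N / 2 ^ j` are at most `b *
2 ^ (d * (j + 1))`, while the factor `l ^ 2` improves by `4 ^ j`. Half of this gain is spent on
summing over the scales, and the other half leaves a weight `2 ^ j` on sites of density about `q ^
j`, where `q` is `scaleRatio`. This weight is a power `κ = log 2 / log q` of the density, so the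
Dirichlet form controls moments of order `α + κ` (`scale_sum_lower_bound`,
`multiscale_energy_bound`, `sum_power_le_dirichlet`). For `Φ(u) = |u| ^ (1 + κ / α)` a small
multiple of this moment plus a constant dominates the Orlicz norm (`orliczNorm_rpow_le`), and `β =
1` suffices.

The Feynman–Kac bound is proved by time discretisation: one weighted step expands the weighted `ℓ²`
norm by at most `exp (h * (2 * L + 2))` (`eventually_weightedStep_norm_le`), Cauchy–Schwarz handles
the product of the steps, and Fatou's lemma passes from Riemann sums to the integral. -/

noncomputable section

namespace ZeroRange

/-! ### Energy estimates for functions on the discrete torus -/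

section Torus

variable {d N : ℕ} [NeZero N]

open Classical in
/-- The sum of the squared increments over ordered pairs of neighbours. -/
def torusEnergy (F : Site d N → ℝ) : ℝ :=
  ∑ x, ∑ y, if Adj x y then (F y - F x) ^ 2 else 0

lemma torusEnergy_nonneg (F : Site d N → ℝ) : 0 ≤ torusEnergy F := by
  unfold torusEnergy
  refine Finset.sum_nonneg fun x _ => Finset.sum_nonneg fun y _ => ?_
  split_ifs <;> positivity

lemma sum_unit_shift_le (F : Site d N → ℝ) (i : Fin d) :
    ∑ x, (F (x + Pi.single i 1) - F x) ^ 2 ≤ torusEnergy F := by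
  classical
  unfold torusEnergy
  refine Finset.sum_le_sum fun x _ => ?_
  have hnn : ∀ y ∈ (Finset.univ : Finset (Site d N)),
      0 ≤ if Adj x y then (F y - F x) ^ 2 else 0 := by
    intro y _
    split_ifs <;> positivity
  -- For `N = 1` the unit shift is the identity and yields no neighbour.
  by_cases h : x = x + Pi.single i 1
  · rw [← h]
    simpa using Finset.sum_nonneg hnn
  · refine le_trans ?_ (Finset.single_le_sum hnn (Finset.mem_univ (x + Pi.single i 1)))
    rw [if_pos ⟨h, i, Or.inl rfl⟩]

/-- The translation by `z` moves every function by at most `s` times the root of its energy. -/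
def ShiftBound (z : Site d N) (s : ℝ) : Prop :=
  ∀ F : Site d N → ℝ, ∑ x, (F (x + z) - F x) ^ 2 ≤ s ^ 2 * torusEnergy F

/-- This is the triangle inequality in `ℓ²`, after a translation of the first increment. It makes
the bound grow with the square of the path length. -/
lemma ShiftBound.add {z w : Site d N} {s t : ℝ} (hs : 0 ≤ s) (ht : 0 ≤ t)
    (hz : ShiftBound z s) (hw : ShiftBound w t) : ShiftBound (z + w) (s + t) := by
  intro F
  have hE := torusEnergy_nonneg F
  have h1 : ∑ x, (F (x + w + z) - F (x + w)) ^ 2 ≤ s ^ 2 * torusEnergy F := by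
    have := Equiv.sum_comp (Equiv.addRight w) (fun x => (F (x + z) - F x) ^ 2)
    simp only [Equiv.coe_addRight] at this
    rw [this]
    exact hz F
  have h2 := hw F
  have hcs := Finset.sum_mul_sq_le_sq_mul_sq Finset.univ
    (fun x => F (x + w + z) - F (x + w)) (fun x => F (x + w) - F x)
  have h3 : ∑ x, (F (x + w + z) - F (x + w)) * (F (x + w) - F x) ≤ s * t * torusEnergy F := by
    refine le_of_sq_le_sq ?_ (by positivity)
    refine hcs.trans ?_
    calc _ ≤ (s ^ 2 * torusEnergy F) * (t ^ 2 * torusEnergy F) := by gcongr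
      _ = _ := by ring
  have h4 : ∑ x, (F (x + (z + w)) - F x) ^ 2
      = ∑ x, (F (x + w + z) - F (x + w)) ^ 2
        + 2 * ∑ x, (F (x + w + z) - F (x + w)) * (F (x + w) - F x)
        + ∑ x, (F (x + w) - F x) ^ 2 := by
    rw [Finset.mul_sum, ← Finset.sum_add_distrib, ← Finset.sum_add_distrib]
    refine Finset.sum_congr rfl fun x _ => ?_
    rw [show x + (z + w) = x + w + z by abel]
    ring
  rw [h4]
  nlinarith

lemma ShiftBound.zero : ShiftBound (0 : Site d N) 0 := by
  intro F
  simp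

lemma ShiftBound.nsmul_single (i : Fin d) (n : ℕ) :
    ShiftBound (n • (Pi.single i 1 : Site d N)) n := by
  induction n with
  | zero => simpa using ShiftBound.zero
  | succ n ih =>
    rw [succ_nsmul]
    push_cast
    refine ih.add (by positivity) zero_le_one fun F => ?_
    simpa using sum_unit_shift_le F i

/-- The displacement with coordinates `v`. -/
def displacement {l : ℕ} (v : Fin d → Fin l) : Site d N := fun i => ((v i : ℕ) : ZMod N)

lemma ShiftBound.displacement {l : ℕ} (v : Fin d → Fin l) :
    ShiftBound (displacement v : Site d N) (d * l) := by
  have h : ∀ s : Finset (Fin d),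
      ShiftBound (∑ i ∈ s, (v i : ℕ) • (Pi.single i 1 : Site d N)) (∑ i ∈ s, ((v i : ℕ) : ℝ)) := by
    intro s
    induction s using Finset.induction_on with
    | empty => simpa using ShiftBound.zero
    | insert i s hi ih =>
      rw [Finset.sum_insert hi, Finset.sum_insert hi]
      exact (ShiftBound.nsmul_single i _).add (by positivity) (by positivity) ih
  have hd : (ZeroRange.displacement v : Site d N)
      = ∑ i, (v i : ℕ) • (Pi.single i 1 : Site d N) := by
    funext j
    simp [ZeroRange.displacement, Finset.sum_apply, Pi.single_apply]
  intro F
  rw [hd]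
  refine (h Finset.univ F).trans ?_
  have hle : ∑ i, ((v i : ℕ) : ℝ) ≤ d * l := by
    calc ∑ i, ((v i : ℕ) : ℝ) ≤ ∑ _i : Fin d, (l : ℝ) :=
          Finset.sum_le_sum fun i _ => by exact_mod_cast (v i).2.le
      _ = d * l := by simp
  have := torusEnergy_nonneg F
  gcongr

omit [NeZero N] in
lemma displacement_injective {l : ℕ} (hl : l ≤ N) :
    Function.Injective (displacement : (Fin d → Fin l) → Site d N) := by
  intro v w h
  funext i
  have hi : ((v i : ℕ) : ZMod N) = ((w i : ℕ) : ZMod N) := congrFun h i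
  rw [ZMod.natCast_eq_natCast_iff', Nat.mod_eq_of_lt (by omega), Nat.mod_eq_of_lt (by omega)] at hi
  exact Fin.ext hi

lemma sum_comp_injective_le {ι κ : Type*} [Fintype ι] [Fintype κ] {e : ι → κ}
    (he : Function.Injective e) {u : κ → ℝ} (hu : ∀ y, 0 ≤ u y) :
    ∑ v, u (e v) ≤ ∑ y, u y := by
  classical
  rw [show ∑ v, u (e v) = ∑ y ∈ Finset.univ.map ⟨e, he⟩, u y from (Finset.sum_map _ ⟨e, he⟩ u).symm]
  exact Finset.sum_le_sum_of_subset_of_nonneg (Finset.subset_univ _) fun y _ _ => hu y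

/-- The difference of the two sides is the square `(a * q - b * p) ^ 2 / (p * q)`. With `p`, `q` the
shifted densities at two sites, it turns an increment of an arbitrary function into a weight that is
positive where the density is larger. -/
lemma pair_le_sq {a b p q : ℝ} (hp : 0 < p) (hq : 0 < q) :
    a ^ 2 * ((p - q) / p) + b ^ 2 * ((q - p) / q) ≤ (b - a) ^ 2 := by
  have h : (b - a) ^ 2 - (a ^ 2 * ((p - q) / p) + b ^ 2 * ((q - p) / q))
      = (a * q - b * p) ^ 2 / (p * q) := by
    field_simp
    ring
  have : 0 ≤ (a * q - b * p) ^ 2 / (p * q) := by positivity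
  linarith

/-- The energy controls the mass sitting at sites where `u` exceeds its averages over blocks
of side `l`. -/
lemma block_energy_bound {l : ℕ} (hl0 : 0 < l) (hl : l ≤ N) {m h : ℝ} (hh : 0 < h)
    {u : Site d N → ℝ} (hu : ∀ x, 0 ≤ u x) (hm : ∑ x, u x ≤ (l : ℝ) ^ d * m)
    (F : Site d N → ℝ) :
    2 * ∑ x, F x ^ 2 * ((u x - m) / (u x + h)) ≤ (d * l) ^ 2 * torusEnergy F := by
  have hD : ∀ x, 0 < u x + h := fun x => by linarith [hu x]
  have hcard : (Fintype.card (Fin d → Fin l) : ℝ) = (l : ℝ) ^ d := by simp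
  have hL : (0 : ℝ) < (l : ℝ) ^ d := by positivity
  have hinj := displacement_injective (d := d) hl
  have key : ∀ v : Fin d → Fin l,
      ∑ x, F x ^ 2 * ((2 * u x - (u (x + displacement v) + u (x - displacement v))) / (u x + h))
        ≤ (d * l) ^ 2 * torusEnergy F := by
    intro v
    refine le_trans ?_ (ShiftBound.displacement v F)
    set z : Site d N := displacement v
    -- Reindexing the backward displacement brings both ends of each pair `(x, x + z)` together for
    -- `pair_le_sq`.
    have h1 : ∑ x, F x ^ 2 * ((u x - u (x - z)) / (u x + h))
        = ∑ x, F (x + z) ^ 2 * ((u (x + z) - u x) / (u (x + z) + h)) := by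
      rw [← Equiv.sum_comp (Equiv.addRight z)]
      simp
    calc _ = ∑ x, F x ^ 2 * ((u x - u (x + z)) / (u x + h))
          + ∑ x, F x ^ 2 * ((u x - u (x - z)) / (u x + h)) := by
          rw [← Finset.sum_add_distrib]
          refine Finset.sum_congr rfl fun x _ => ?_
          ring
      _ = ∑ x, (F x ^ 2 * ((u x - u (x + z)) / (u x + h))
          + F (x + z) ^ 2 * ((u (x + z) - u x) / (u (x + z) + h))) := by
          rw [h1, Finset.sum_add_distrib]
      _ ≤ _ := by
          refine Finset.sum_le_sum fun x _ => ?_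
          have := pair_le_sq (a := F x) (b := F (x + z)) (hD x) (hD (x + z))
          simpa using this
  have hsum := Finset.sum_le_sum fun v (_ : v ∈ (Finset.univ : Finset (Fin d → Fin l))) => key v
  rw [Finset.sum_const, Finset.card_univ, nsmul_eq_mul, hcard, Finset.sum_comm] at hsum
  have hlow : (l : ℝ) ^ d * (2 * ∑ x, F x ^ 2 * ((u x - m) / (u x + h))) ≤
      ∑ x, ∑ v : Fin d → Fin l,
        F x ^ 2 * ((2 * u x - (u (x + displacement v) + u (x - displacement v))) / (u x + h)) := by
    rw [Finset.mul_sum, Finset.mul_sum]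
    refine Finset.sum_le_sum fun x _ => ?_
    rw [← Finset.mul_sum, ← Finset.sum_div, Finset.sum_sub_distrib, Finset.sum_add_distrib,
      Finset.sum_const, Finset.card_univ, nsmul_eq_mul, hcard]
    -- The points of a block are distinct, so the mass of a block is at most the total mass.
    have h1 : ∑ v : Fin d → Fin l, u (x + displacement v) ≤ (l : ℝ) ^ d * m :=
      (sum_comp_injective_le ((add_right_injective x).comp hinj) hu).trans hm
    have h2 : ∑ v : Fin d → Fin l, u (x - displacement v) ≤ (l : ℝ) ^ d * m :=
      (sum_comp_injective_le ((sub_right_injective (b := x)).comp hinj) hu).trans hm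
    calc (l : ℝ) ^ d * (2 * (F x ^ 2 * ((u x - m) / (u x + h))))
        = F x ^ 2 * (((l : ℝ) ^ d * (2 * u x) - ((l : ℝ) ^ d * m + (l : ℝ) ^ d * m))
          / (u x + h)) := by ring
      _ ≤ _ := by
        have := (hD x).le
        gcongr
  exact le_of_mul_le_mul_left (hlow.trans hsum) hL

/-- The block estimate at the scale `2 ^ (-j)`. -/
lemma scale_energy_bound {j : ℕ} (hj : 2 ^ j ≤ N) {b h : ℝ} (hb : 0 ≤ b) (hh : 0 < h)
    {u : Site d N → ℝ} (hu : ∀ x, 0 ≤ u x) (hm : ∑ x, u x ≤ b * (N : ℝ) ^ d)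
    (F : Site d N → ℝ) :
    2 * 4 ^ j * ∑ x, F x ^ 2 * ((u x - b * (2 ^ d) ^ (j + 1)) / (u x + h))
      ≤ (d * N) ^ 2 * torusEnergy F := by
  have hl0 : 0 < N / 2 ^ j := Nat.div_pos hj (by positivity)
  have hle : (N / 2 ^ j) * 2 ^ j ≤ N := Nat.div_mul_le_self _ _
  -- Rounding the side `N / 2 ^ j` down costs at most a factor two, whence the exponent `j + 1` in
  -- the bound on block averages.
  have hge : N ≤ (N / 2 ^ j) * 2 ^ (j + 1) := by
    have h1 : N < 2 ^ j * (N / 2 ^ j + 1) := Nat.lt_mul_div_succ N (by positivity)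
    have h2 : 2 ^ j * (N / 2 ^ j + 1) ≤ 2 ^ j * (2 * (N / 2 ^ j)) :=
      Nat.mul_le_mul_left _ (by omega)
    calc N ≤ 2 ^ j * (2 * (N / 2 ^ j)) := h1.le.trans h2
      _ = _ := by ring
  have hle' : ((N / 2 ^ j : ℕ) : ℝ) * 2 ^ j ≤ N := by exact_mod_cast hle
  have hge' : (N : ℝ) ≤ ((N / 2 ^ j : ℕ) : ℝ) * 2 ^ (j + 1) := by exact_mod_cast hge
  have hE := torusEnergy_nonneg F
  have hmass : ∑ x, u x ≤ ((N / 2 ^ j : ℕ) : ℝ) ^ d * (b * (2 ^ d) ^ (j + 1)) := by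
    refine hm.trans ?_
    calc b * (N : ℝ) ^ d ≤ b * (((N / 2 ^ j : ℕ) : ℝ) * 2 ^ (j + 1)) ^ d := by gcongr
      _ = _ := by rw [mul_pow, ← pow_mul, ← pow_mul, mul_comm (j + 1) d]; ring
  have := block_energy_bound hl0 (Nat.div_le_self _ _) hh hu hmass F
  calc 2 * 4 ^ j * ∑ x, F x ^ 2 * ((u x - b * (2 ^ d) ^ (j + 1)) / (u x + h))
      = 4 ^ j * (2 * ∑ x, F x ^ 2 * ((u x - b * (2 ^ d) ^ (j + 1)) / (u x + h))) := by ring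
    _ ≤ 4 ^ j * ((d * (N / 2 ^ j : ℕ)) ^ 2 * torusEnergy F) := by gcongr
    _ = (d * (((N / 2 ^ j : ℕ) : ℝ) * 2 ^ j)) ^ 2 * torusEnergy F := by
      rw [show (4 : ℝ) = 2 ^ 2 by norm_num, ← pow_mul, mul_comm 2 j, pow_mul]
      ring
    _ ≤ _ := by gcongr

end Torus

/-! ### Combination of the dyadic scales -/

section Thresholds

/-- The ratio of the thresholds of consecutive scales. -/
def scaleRatio (d : ℕ) (α : ℝ) : ℝ := 4 * ((2 : ℝ) ^ d) ^ (α + 1)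

/-- The gain of integrability: `scaleRatio` to this power is `2`. -/
def gainExponent (d : ℕ) (α : ℝ) : ℝ := Real.log 2 / Real.log (scaleRatio d α)

/-- The threshold above which sites are controlled at the scale `2 ^ (-j)`. -/
def threshold (d : ℕ) (α b : ℝ) (j : ℕ) : ℝ :=
  2 * (1 + b * 2 ^ d) ^ (α + 1) * scaleRatio d α ^ j

variable {d : ℕ} {α b : ℝ}

lemma one_le_two_pow_rpow (d : ℕ) (hα : 0 < α) : 1 ≤ ((2 : ℝ) ^ d) ^ (α + 1) :=
  Real.one_le_rpow (one_le_pow₀ one_le_two) (by linarith)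

lemma four_le_scaleRatio (d : ℕ) (hα : 0 < α) : 4 ≤ scaleRatio d α := by
  have := one_le_two_pow_rpow d hα
  unfold scaleRatio
  linarith

lemma gainExponent_pos (d : ℕ) (hα : 0 < α) : 0 < gainExponent d α := by
  have := four_le_scaleRatio d hα
  exact div_pos (Real.log_pos one_lt_two) (Real.log_pos (by linarith))

lemma scaleRatio_rpow_gainExponent (d : ℕ) (hα : 0 < α) :
    scaleRatio d α ^ gainExponent d α = 2 := by
  have h := four_le_scaleRatio d hα
  have hl : 0 < Real.log (scaleRatio d α) := Real.log_pos (by linarith)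
  rw [Real.rpow_def_of_pos (by linarith), gainExponent, mul_div_cancel₀ _ hl.ne',
    Real.exp_log two_pos]

lemma threshold_pos (hα : 0 < α) (hb : 0 < b) (j : ℕ) : 0 < threshold d α b j := by
  have := four_le_scaleRatio d hα
  unfold threshold
  positivity

/-- At a site above the threshold of scale `j`, the bound on the block averages plus one particle is
at most half of the density. The same inequality excludes thresholds at scales finer than the
lattice. -/
lemma two_mul_le_threshold (hα : 0 < α) (hb : 0 < b) (j : ℕ) :
    2 * ((1 + b * 2 ^ d) * (2 ^ d) ^ j) ≤ threshold d α b j := by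
  have hB : 1 ≤ 1 + b * 2 ^ d := by
    have : 0 < b * 2 ^ d := by positivity
    linarith
  have hD : (1 : ℝ) ≤ 2 ^ d := one_le_pow₀ one_le_two
  have h1 : 1 + b * 2 ^ d ≤ (1 + b * 2 ^ d) ^ (α + 1) := by
    simpa using Real.rpow_le_rpow_of_exponent_le hB (show (1 : ℝ) ≤ α + 1 by linarith)
  have h2 : (2 : ℝ) ^ d ≤ scaleRatio d α := by
    have : (2 : ℝ) ^ d ≤ ((2 : ℝ) ^ d) ^ (α + 1) := by
      simpa using Real.rpow_le_rpow_of_exponent_le hD (show (1 : ℝ) ≤ α + 1 by linarith)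
    unfold scaleRatio
    linarith
  unfold threshold
  rw [mul_assoc]
  gcongr

/-- A scale contributes negatively only when `e` is below `s = c + b * (2 ^ d) ^ (j + 1)`, and then
by at most `s ^ (α + 1) * 2 ^ j / threshold`. The thresholds grow by the factor `4 * (2 ^ d) ^ (α +
1)` precisely to make this loss summable in `j`. -/
lemma scale_term_lower_bound (hα : 0 < α) (hb : 0 < b) {c e : ℝ} (hc0 : 0 < c) (hc1 : c ≤ 1)
    (he : 0 ≤ e) (j : ℕ) :
    -(1 / 2 * (1 / 2) ^ j) ≤
      e ^ α * (2 ^ j * ((e - c - b * (2 ^ d) ^ (j + 1)) / (e + threshold d α b j))) := by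
  have hM := threshold_pos (d := d) hα hb j
  set s : ℝ := c + b * (2 ^ d) ^ (j + 1) with hs
  have hs0 : 0 < s := by positivity
  rw [show e - c - b * (2 ^ d) ^ (j + 1) = e - s by rw [hs]; ring]
  rcases le_total s e with h | h
  · have : 0 ≤ e ^ α * (2 ^ j * ((e - s) / (e + threshold d α b j))) := by
      have := sub_nonneg.2 h
      positivity
    have h2 : (0 : ℝ) ≤ 1 / 2 * (1 / 2) ^ j := by positivity
    linarith
  · have hsB : s ≤ (1 + b * 2 ^ d) * (2 ^ d) ^ j := by
      have hD : (1 : ℝ) ≤ (2 ^ d) ^ j := one_le_pow₀ (one_le_pow₀ one_le_two)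
      calc s ≤ (2 ^ d) ^ j + b * (2 ^ d) ^ (j + 1) := by rw [hs]; linarith
        _ = _ := by ring
    have hsM : s ^ α * s * (2 * 4 ^ j) ≤ threshold d α b j := by
      have h1 : s ^ α * s = s ^ (α + 1) := by rw [Real.rpow_add_one hs0.ne']
      have h2 : s ^ (α + 1) ≤ (1 + b * 2 ^ d) ^ (α + 1) * (((2 : ℝ) ^ d) ^ (α + 1)) ^ j := by
        calc s ^ (α + 1) ≤ ((1 + b * 2 ^ d) * (2 ^ d) ^ j) ^ (α + 1) := by gcongr
          _ = _ := by
            rw [Real.mul_rpow (by positivity) (by positivity), ← Real.rpow_natCast_mul,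
              mul_comm (j : ℝ), Real.rpow_mul_natCast] <;> positivity
      rw [h1]
      calc s ^ (α + 1) * (2 * 4 ^ j)
          ≤ (1 + b * 2 ^ d) ^ (α + 1) * (((2 : ℝ) ^ d) ^ (α + 1)) ^ j * (2 * 4 ^ j) := by gcongr
        _ = threshold d α b j := by
          unfold threshold scaleRatio
          rw [mul_pow]
          ring
    have h3 : e ^ α * (2 ^ j * ((s - e) / (e + threshold d α b j)))
        ≤ s ^ α * (2 ^ j * (s / threshold d α b j)) := by
      gcongr
      · linarith
      · linarith
    have h4 : s ^ α * (2 ^ j * (s / threshold d α b j)) ≤ 1 / 2 * (1 / 2) ^ j := by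
      rw [show s ^ α * (2 ^ j * (s / threshold d α b j))
        = s ^ α * s * 2 ^ j / threshold d α b j by ring, div_le_iff₀ hM]
      calc s ^ α * s * 2 ^ j = (1 / 2 * (1 / 2) ^ j) * (s ^ α * s * (2 * 4 ^ j)) := by
            rw [show (4 : ℝ) = 2 * 2 by norm_num, mul_pow, one_div, inv_pow]
            field_simp
        _ ≤ _ := by gcongr
    have h5 : e ^ α * (2 ^ j * ((e - s) / (e + threshold d α b j)))
        = -(e ^ α * (2 ^ j * ((s - e) / (e + threshold d α b j)))) := by ring
    linarith

/-- The sum of the contributions of all scales controls a power larger than `α`. -/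
lemma scale_sum_lower_bound (hα : 0 < α) (hb : 0 < b) {N : ℕ} (hN : 0 < N) {c e : ℝ}
    (hc0 : 0 < c) (hc1 : c ≤ 1) (he : 0 ≤ e) (heN : e ≤ b * (N : ℝ) ^ d) :
    1 / 8 / threshold d α b 0 ^ gainExponent d α * e ^ (α + gainExponent d α)
        - (1 + threshold d α b 0 ^ α) ≤
      e ^ α * ∑ j ∈ Finset.range (Nat.log 2 N + 1),
        2 ^ j * ((e - c - b * (2 ^ d) ^ (j + 1)) / (e + threshold d α b j)) := by
  set C := threshold d α b 0 with hC
  set κ := gainExponent d α with hκ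
  have hC0 : 0 < C := threshold_pos hα hb 0
  have hκ0 : 0 < κ := gainExponent_pos d hα
  have hq := four_le_scaleRatio d hα
  have hMj : ∀ j, threshold d α b j = C * scaleRatio d α ^ j := by
    intro j
    simp [hC, threshold]
  have hlow := fun j => scale_term_lower_bound (d := d) hα hb hc0 hc1 he j
  have hgeom : ∀ s : Finset ℕ, ∑ j ∈ s, (1 / 2 * (1 / 2 : ℝ) ^ j) ≤ 1 := by
    intro s
    have h1 : HasSum (fun j : ℕ => 1 / 2 * (1 / 2 : ℝ) ^ j) 1 := by
      simpa using hasSum_geometric_two.mul_left (1 / 2 : ℝ)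
    exact sum_le_hasSum s (fun j _ => by positivity) h1
  have hpow : 1 / 8 / C ^ κ * e ^ (α + κ) = 1 / 8 * (e ^ α * (e / C) ^ κ) := by
    rw [Real.rpow_add_of_nonneg he hα.le hκ0.le, Real.div_rpow he hC0.le]
    ring
  rw [hpow, Finset.mul_sum]
  -- Below the first threshold the power is bounded by a constant. Above it, one scale supplies the
  -- power and the losses of the others sum to at most one.
  rcases lt_or_ge e C with h | h
  · have h1 : e ^ α * (e / C) ^ κ ≤ C ^ α * 1 := by
      gcongr
      exact Real.rpow_le_one (by positivity) (by rw [div_le_one hC0]; exact h.le) hκ0.le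
    have h2 := Finset.sum_le_sum fun j (_ : j ∈ Finset.range (Nat.log 2 N + 1)) => hlow j
    rw [Finset.sum_neg_distrib] at h2
    have h3 := hgeom (Finset.range (Nat.log 2 N + 1))
    have h4 : 0 < C ^ α := by positivity
    linarith
  · obtain ⟨j, hj1, hj2⟩ := exists_nat_pow_near (x := e / C) (y := scaleRatio d α)
      (by rwa [one_le_div hC0]) (by linarith)
    have hje : threshold d α b j ≤ e := by
      rw [hMj, mul_comm]
      rwa [le_div_iff₀ hC0] at hj1
    have h2M := two_mul_le_threshold (d := d) hα hb j
    -- The scale must be one of those summed: otherwise its threshold would exceed the largest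
    -- density `b * N ^ d` that the mass bound allows.
    have hjN : 2 ^ j ≤ N := by
      by_contra hcon
      push Not at hcon
      have h1 : (N : ℝ) ^ d ≤ (2 ^ d) ^ j := by
        calc (N : ℝ) ^ d ≤ (2 ^ j) ^ d := by
              gcongr
              exact_mod_cast hcon.le
          _ = _ := by rw [← pow_mul, ← pow_mul, mul_comm]
      have hD : (1 : ℝ) ≤ 2 ^ d := one_le_pow₀ one_le_two
      have hD' : (1 : ℝ) ≤ (2 ^ d) ^ j := one_le_pow₀ hD
      have h3 : b * (N : ℝ) ^ d ≤ b * 2 ^ d * (2 ^ d) ^ j := by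
        calc b * (N : ℝ) ^ d ≤ b * (2 ^ d) ^ j := by gcongr
          _ ≤ b * (2 ^ d) ^ j * 2 ^ d := le_mul_of_one_le_right (by positivity) hD
          _ = _ := by ring
      have h4 : 0 < b * 2 ^ d * (2 ^ d) ^ j := by positivity
      linarith
    have hmem : j ∈ Finset.range (Nat.log 2 N + 1) := by
      rw [Finset.mem_range, Nat.lt_succ_iff]
      exact Nat.le_log_of_pow_le one_lt_two hjN
    have hterm : 1 / 8 * (e ^ α * (e / C) ^ κ) ≤
        e ^ α * (2 ^ j * ((e - c - b * (2 ^ d) ^ (j + 1)) / (e + threshold d α b j))) := by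
      -- The exponent `κ` is chosen so that passing to the next threshold doubles the power, like
      -- the weight `2 ^ j`.
      have h1 : (e / C) ^ κ ≤ 2 * 2 ^ j := by
        calc (e / C) ^ κ ≤ (scaleRatio d α ^ (j + 1)) ^ κ := by gcongr
          _ = 2 ^ (j + 1) := by
            rw [← Real.rpow_natCast_mul (by linarith), mul_comm, Real.rpow_mul_natCast (by linarith),
              scaleRatio_rpow_gainExponent d hα]
          _ = _ := by ring
      -- The numerator is at least `e / 2` and the denominator at most `2 * e`.
      have h2 : 1 / 4 ≤ (e - c - b * (2 ^ d) ^ (j + 1)) / (e + threshold d α b j) := by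
        have hM := threshold_pos (d := d) hα hb j
        rw [le_div_iff₀ (by positivity)]
        have hD : (1 : ℝ) ≤ (2 ^ d) ^ j := one_le_pow₀ (one_le_pow₀ one_le_two)
        have : c + b * (2 ^ d) ^ (j + 1) ≤ (1 + b * 2 ^ d) * (2 ^ d) ^ j := by
          calc c + b * (2 ^ d) ^ (j + 1) ≤ (2 ^ d) ^ j + b * (2 ^ d) ^ (j + 1) := by linarith
            _ = _ := by ring
        linarith
      calc 1 / 8 * (e ^ α * (e / C) ^ κ) ≤ 1 / 8 * (e ^ α * (2 * 2 ^ j)) := by gcongr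
        _ = e ^ α * (2 ^ j * (1 / 4)) := by ring
        _ ≤ _ := by gcongr
    rw [← Finset.add_sum_erase _ _ hmem]
    have h2 := Finset.sum_le_sum fun i
      (_ : i ∈ (Finset.range (Nat.log 2 N + 1)).erase j) => hlow i
    rw [Finset.sum_neg_distrib] at h2
    have h3 := hgeom ((Finset.range (Nat.log 2 N + 1)).erase j)
    have h4 : 0 < C ^ α := by positivity
    linarith

/-- The sum over all scales of the block estimates. -/
lemma multiscale_energy_bound {N : ℕ} [NeZero N] (hα : 0 < α) (hb : 0 < b) {c : ℝ} (hc : 0 < c)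
    {u : Site d N → ℝ} (hu : ∀ x, 0 ≤ u x) (hm : ∑ x, u x ≤ b * (N : ℝ) ^ d)
    (F : Site d N → ℝ) :
    ∑ x, F x ^ 2 * ∑ j ∈ Finset.range (Nat.log 2 N + 1),
        2 ^ j * ((u x + c - c - b * (2 ^ d) ^ (j + 1)) / (u x + c + threshold d α b j))
      ≤ (d * N) ^ 2 * torusEnergy F := by
  have hE := torusEnergy_nonneg F
  -- The weight `2 ^ j` against the factor `4 ^ j` of the block estimate leaves a geometric series.
  have hterm : ∀ j ∈ Finset.range (Nat.log 2 N + 1),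
      ∑ x, F x ^ 2 *
        (2 ^ j * ((u x + c - c - b * (2 ^ d) ^ (j + 1)) / (u x + c + threshold d α b j)))
      ≤ (1 / 2 * (1 / 2) ^ j) * (1 / 2 * ((d * N) ^ 2 * torusEnergy F)) * 2 := by
    intro j hj
    have hj' : 2 ^ j ≤ N :=
      Nat.pow_le_of_le_log (NeZero.ne N) (by rw [Finset.mem_range] at hj; omega)
    have hM := threshold_pos (d := d) hα hb j
    have h := scale_energy_bound hj' hb.le (h := c + threshold d α b j) (by positivity) hu hm F
    calc _ = (1 / 2 * (1 / 2) ^ j) *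
          (2 * 4 ^ j * ∑ x, F x ^ 2 * ((u x - b * (2 ^ d) ^ (j + 1))
            / (u x + (c + threshold d α b j)))) := by
          rw [show (4 : ℝ) = 2 * 2 by norm_num, mul_pow, one_div, inv_pow, Finset.mul_sum,
            Finset.mul_sum]
          refine Finset.sum_congr rfl fun x _ => ?_
          rw [add_sub_cancel_right, add_assoc]
          field_simp
      _ ≤ (1 / 2 * (1 / 2) ^ j) * ((d * N) ^ 2 * torusEnergy F) := by gcongr
      _ = _ := by ring
  have hgeom : ∑ j ∈ Finset.range (Nat.log 2 N + 1), (1 / 2 * (1 / 2 : ℝ) ^ j) ≤ 1 := by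
    have h1 : HasSum (fun j : ℕ => 1 / 2 * (1 / 2 : ℝ) ^ j) 1 := by
      simpa using hasSum_geometric_two.mul_left (1 / 2 : ℝ)
    exact sum_le_hasSum _ (fun j _ => by positivity) h1
  simp_rw [Finset.mul_sum]
  rw [Finset.sum_comm]
  refine (Finset.sum_le_sum hterm).trans ?_
  rw [← Finset.sum_mul, ← Finset.sum_mul]
  have h0 : 0 ≤ (d * N : ℝ) ^ 2 * torusEnergy F := by positivity
  nlinarith

end Thresholds

/-! ### The Dirichlet form and its gain of integrability -/

section QuadraticForm

variable {d N : ℕ} [NeZero N] {α c a b : ℝ}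

/-- The configurations with at most `m` units of mass. -/
def massSet (d N : ℕ) [NeZero N] (c m : ℝ) : Set (Config d N) := {k | ∑ x, density c k x ≤ m}

lemma massSet_finite (hc : 0 < c) (m : ℝ) : (massSet d N c m).Finite := by
  refine Set.Finite.subset (Set.finite_Iic (fun _ : Site d N => ⌊m / c⌋₊)) fun k hk x => ?_
  have h1 : density c k x ≤ m :=
    (Finset.single_le_sum (f := density c k)
      (fun y _ => by unfold density; positivity) (Finset.mem_univ x)).trans hk
  exact Nat.le_floor (by rw [le_div_iff₀ hc, mul_comm]; exact h1)

/-- `massSet` as a finite set. -/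
def massFinset (d N : ℕ) [NeZero N] (hc : 0 < c) (m : ℝ) : Finset (Config d N) :=
  (massSet_finite (d := d) (N := N) hc m).toFinset

lemma mem_massFinset (hc : 0 < c) {m : ℝ} {k : Config d N} :
    k ∈ massFinset d N hc m ↔ ∑ x, density c k x ≤ m := by
  simp [massFinset, massSet]

omit [NeZero N] in
lemma density_add_single_self (z : Config d N) (x : Site d N) :
    density c (z + Pi.single x 1) x = density c z x + c := by
  simp [density]
  ring

lemma sum_density_add_single (z : Config d N) (x : Site d N) :
    ∑ y, density c (z + Pi.single x 1) y = ∑ y, density c z y + c := by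
  simp only [density, Pi.add_apply, Nat.cast_add, mul_add, Finset.sum_add_distrib]
  congr 1
  rw [← Finset.mul_sum, ← Nat.cast_sum]
  simp

omit [NeZero N] in
lemma sub_single_add_single {k : Config d N} {x : Site d N} (hk : k x ≠ 0) :
    k - Pi.single x 1 + Pi.single x 1 = k := by
  refine tsub_add_cancel_of_le fun y => ?_
  by_cases h : y = x
  · subst h
    simpa using Nat.one_le_iff_ne_zero.2 hk
  · simp [h]

omit [NeZero N] in
lemma move_add_single (z : Config d N) (x y : Site d N) :
    move (z + Pi.single x 1) x y = z + Pi.single y 1 := by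
  unfold move
  rw [add_tsub_cancel_right]

lemma sum_density_move {k : Config d N} {x y : Site d N} (hk : k x ≠ 0) :
    ∑ z, density c (move k x y) z = ∑ z, density c k z := by
  conv_rhs => rw [← sub_single_add_single hk]
  rw [move, sum_density_add_single, sum_density_add_single]

lemma partitionFn_nonneg (α : ℝ) {u : ℝ} (hu : 0 ≤ u) : 0 ≤ partitionFn α u :=
  tsum_nonneg fun _ => by positivity

lemma equilibrium_nonneg (hc : 0 < c) (ha : 0 < a) (k : Config d N) :
    0 ≤ equilibrium α c a k := by
  have := partitionFn_nonneg α (div_pos ha hc).le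
  exact Finset.prod_nonneg fun x _ => by positivity

/-- The factor `(j!) ^ α` in the equilibrium weight is the product of the jump rates, so one more
particle cancels against its own rate. The right side does not depend on `x`, which encodes detailed
balance. -/
lemma equilibrium_add_single (hc : 0 < c) (ha : 0 < a) (z : Config d N) (x : Site d N) :
    equilibrium α c a (z + Pi.single x 1) * density c (z + Pi.single x 1) x ^ α
      = a ^ α * equilibrium α c a z := by
  classical
  unfold equilibrium
  rw [← Finset.prod_erase_mul _ _ (Finset.mem_univ x),
    ← Finset.prod_erase_mul Finset.univ _ (Finset.mem_univ x)]
  have h1 : ∀ y ∈ Finset.univ.erase x, (z + Pi.single x 1 : Config d N) y = z y := by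
    intro y hy
    simp [Finset.ne_of_mem_erase hy]
  rw [Finset.prod_congr rfl fun y hy => by rw [h1 y hy]]
  have hx : (z + Pi.single x 1 : Config d N) x = z x + 1 := by simp
  have h2 : (a / c) ^ (α * ((z x + 1 : ℕ) : ℝ)) /
        (((z x + 1).factorial : ℝ) ^ α * partitionFn α (a / c)) * (c * ((z x + 1 : ℕ) : ℝ)) ^ α
      = a ^ α * ((a / c) ^ (α * (z x : ℝ)) /
        (((z x).factorial : ℝ) ^ α * partitionFn α (a / c))) := by
    have hac : 0 < a / c := by positivity
    have hj : (0 : ℝ) < ((z x + 1 : ℕ) : ℝ) := by positivity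
    rw [Nat.factorial_succ, Nat.cast_mul, Real.mul_rpow hj.le (by positivity),
      Real.mul_rpow hc.le hj.le,
      show α * ((z x + 1 : ℕ) : ℝ) = α * (z x : ℝ) + α by push_cast; ring,
      Real.rpow_add hac, Real.div_rpow ha.le hc.le α]
    have h3 : (0 : ℝ) < ((z x + 1 : ℕ) : ℝ) ^ α := by positivity
    have h4 : (0 : ℝ) < c ^ α := by positivity
    field_simp
  simp only [density]
  rw [hx, mul_assoc, h2]
  ring

/-- Summation over configurations with a marked particle at `x`. -/
lemma sum_equilibrium_mul_rate (hα : 0 < α) (hc : 0 < c) (ha : 0 < a) (m : ℝ) (x : Site d N)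
    (g : Config d N → ℝ) :
    ∑ k ∈ massFinset d N hc m, equilibrium α c a k * density c k x ^ α * g k
      = a ^ α * ∑ z ∈ massFinset d N hc (m - c),
          equilibrium α c a z * g (z + Pi.single x 1) := by
  classical
  -- The rate vanishes at an empty site; on the other configurations, removing a particle at `x` is
  -- a bijection.
  have h0 : ∑ k ∈ (massFinset d N hc m).filter (fun k => k x ≠ 0),
        equilibrium α c a k * density c k x ^ α * g k
      = ∑ k ∈ massFinset d N hc m, equilibrium α c a k * density c k x ^ α * g k := by
    refine Finset.sum_filter_of_ne fun k _ hk hx => hk ?_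
    simp [density, hx, Real.zero_rpow hα.ne']
  rw [← h0, Finset.mul_sum]
  refine Finset.sum_nbij' (fun k => k - Pi.single x 1) (fun z => z + Pi.single x 1) ?_ ?_ ?_ ?_ ?_
  · intro k hk
    rw [Finset.mem_filter, mem_massFinset] at hk
    rw [mem_massFinset]
    have := sum_density_add_single (c := c) (k - Pi.single x 1) x
    rw [sub_single_add_single hk.2] at this
    linarith [hk.1]
  · intro z hz
    rw [mem_massFinset] at hz
    rw [Finset.mem_filter, mem_massFinset, sum_density_add_single]
    exact ⟨by linarith, by simp⟩
  · intro k hk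
    exact sub_single_add_single (Finset.mem_filter.1 hk).2
  · intro z _
    exact add_tsub_cancel_right _ _
  · intro k hk
    have h := equilibrium_add_single (α := α) hc ha (k - Pi.single x 1) x
    rw [sub_single_add_single (Finset.mem_filter.1 hk).2] at h ⊢
    rw [h]
    ring

omit [NeZero N] in
lemma adj_comm (x y : Site d N) : Adj x y ↔ Adj y x := by
  unfold Adj
  refine and_congr ne_comm (exists_congr fun i => or_comm)

/-- Summation by parts: exchange the two endpoints in one of two copies of the sum. -/
lemma sum_adj_mul_sub (F : Site d N → ℝ) :
    torusEnergy F = -2 * ∑ x, ∑ y, open Classical in if Adj x y then F x * (F y - F x) else 0 := by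
  classical
  have h : (∑ x, ∑ y, if Adj x y then F x * (F y - F x) else 0)
      = ∑ x, ∑ y, if Adj x y then F y * (F x - F y) else 0 := by
    rw [Finset.sum_comm]
    refine Finset.sum_congr rfl fun x _ => Finset.sum_congr rfl fun y _ => ?_
    simp only [adj_comm y x]
  rw [show -2 * ∑ x, ∑ y, (if Adj x y then F x * (F y - F x) else 0)
      = -(∑ x, ∑ y, if Adj x y then F x * (F y - F x) else 0)
        - ∑ x, ∑ y, if Adj x y then F x * (F y - F x) else 0 by ring]
  nth_rewrite 1 [h]
  rw [← Finset.sum_neg_distrib, ← Finset.sum_sub_distrib]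
  unfold torusEnergy
  refine Finset.sum_congr rfl fun x _ => ?_
  rw [← Finset.sum_neg_distrib, ← Finset.sum_sub_distrib]
  refine Finset.sum_congr rfl fun y _ => ?_
  split_ifs
  · ring
  · simp

/-- The Dirichlet form of the generator, as an average of energies on the torus. -/
lemma sum_equilibrium_mul_gen (hα : 0 < α) (hc : 0 < c) (ha : 0 < a) (m : ℝ)
    (f : Config d N → ℝ) :
    ∑ k ∈ massFinset d N hc m, equilibrium α c a k * f k * gen α c f k
      = -((N : ℝ) ^ 2 * a ^ α / (4 * c)) * ∑ z ∈ massFinset d N hc (m - c),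
          equilibrium α c a z * torusEnergy (fun x => f (z + Pi.single x 1)) := by
  classical
  have h1 : ∀ k, equilibrium α c a k * f k * gen α c f k
      = (N : ℝ) ^ 2 / (2 * c) * ∑ x, ∑ y, equilibrium α c a k * density c k x ^ α *
          (if Adj x y then f k * (f (move k x y) - f k) else 0) := by
    intro k
    rw [gen, Finset.mul_sum, Finset.mul_sum, Finset.mul_sum, Finset.mul_sum]
    refine Finset.sum_congr rfl fun x _ => ?_
    rw [Finset.mul_sum, Finset.mul_sum, Finset.mul_sum, Finset.mul_sum]
    refine Finset.sum_congr rfl fun y _ => ?_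
    split_ifs
    · field_simp
    · simp
  simp_rw [h1]
  rw [← Finset.mul_sum, Finset.sum_comm]
  have h2 : ∀ x, ∑ k ∈ massFinset d N hc m, ∑ y, equilibrium α c a k * density c k x ^ α *
          (if Adj x y then f k * (f (move k x y) - f k) else 0)
      = ∑ z ∈ massFinset d N hc (m - c), a ^ α * (equilibrium α c a z *
        ∑ y, if Adj x y then f (z + Pi.single x 1) *
          (f (z + Pi.single y 1) - f (z + Pi.single x 1)) else 0) := by
    intro x
    simp_rw [← Finset.mul_sum]
    rw [sum_equilibrium_mul_rate hα hc ha m x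
      (fun k => ∑ y, if Adj x y then f k * (f (move k x y) - f k) else 0)]
    simp_rw [move_add_single]
  simp_rw [h2]
  rw [Finset.sum_comm, Finset.mul_sum, Finset.mul_sum]
  refine Finset.sum_congr rfl fun z _ => ?_
  rw [sum_adj_mul_sub, ← Finset.mul_sum, ← Finset.mul_sum]
  field_simp
  ring

/-- The Dirichlet form controls the expectation of a power of the density larger than `α`. -/
lemma sum_power_le_dirichlet (hd : 1 ≤ d) (hα : 0 < α) (hb : 0 < b) (hc : 0 < c) (hc1 : c ≤ 1)
    (ha : 0 < a) (f : Config d N → ℝ) :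
    ∑ k ∈ massFinset d N hc (b * (N : ℝ) ^ d), equilibrium α c a k * f k ^ 2 *
        ∑ x, (1 / 8 / threshold d α b 0 ^ gainExponent d α *
          density c k x ^ (α + gainExponent d α) - (1 + threshold d α b 0 ^ α))
      ≤ -(4 * d ^ 2 * c) * ∑ k ∈ massFinset d N hc (b * (N : ℝ) ^ d),
          equilibrium α c a k * f k * gen α c f k := by
  set m : ℝ := b * (N : ℝ) ^ d with hm
  set G : ℝ → ℝ := fun e => ∑ j ∈ Finset.range (Nat.log 2 N + 1),
        2 ^ j * ((e - c - b * (2 ^ d) ^ (j + 1)) / (e + threshold d α b j)) with hG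
  have hπ := fun k : Config d N => equilibrium_nonneg (α := α) hc ha k
  have hdens : ∀ (k : Config d N) x, 0 ≤ density c k x := fun k x => by
    unfold density; positivity
  have step1 : ∑ k ∈ massFinset d N hc m, equilibrium α c a k * f k ^ 2 *
        ∑ x, (1 / 8 / threshold d α b 0 ^ gainExponent d α *
          density c k x ^ (α + gainExponent d α) - (1 + threshold d α b 0 ^ α))
      ≤ ∑ k ∈ massFinset d N hc m, equilibrium α c a k * f k ^ 2 *
        ∑ x, density c k x ^ α * G (density c k x) := by
    refine Finset.sum_le_sum fun k hk => ?_
    rw [mem_massFinset] at hk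
    have := hπ k
    gcongr with x
    refine scale_sum_lower_bound hα hb (NeZero.pos N) hc hc1 (hdens k x) ?_
    exact (Finset.single_le_sum (f := density c k) (fun y _ => hdens k y)
      (Finset.mem_univ x)).trans hk
  have step2 : ∑ k ∈ massFinset d N hc m, equilibrium α c a k * f k ^ 2 *
        ∑ x, density c k x ^ α * G (density c k x)
      = a ^ α * ∑ z ∈ massFinset d N hc (m - c), equilibrium α c a z *
          ∑ x, f (z + Pi.single x 1) ^ 2 * G (density c z x + c) := by
    have h1 : ∀ x, ∑ k ∈ massFinset d N hc m, equilibrium α c a k * f k ^ 2 *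
          (density c k x ^ α * G (density c k x))
        = a ^ α * ∑ z ∈ massFinset d N hc (m - c), equilibrium α c a z *
          (f (z + Pi.single x 1) ^ 2 * G (density c z x + c)) := by
      intro x
      have := sum_equilibrium_mul_rate (α := α) hα hc ha m x
        (fun k => f k ^ 2 * G (density c k x))
      simp only [density_add_single_self] at this
      rw [← this]
      refine Finset.sum_congr rfl fun k _ => ?_
      ring
    simp_rw [Finset.mul_sum]
    rw [Finset.sum_comm]
    simp_rw [h1, Finset.mul_sum]
    rw [Finset.sum_comm]
  have step3 : ∀ z ∈ massFinset d N hc (m - c), equilibrium α c a z *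
          ∑ x, f (z + Pi.single x 1) ^ 2 * G (density c z x + c)
      ≤ equilibrium α c a z * ((d * N) ^ 2 * torusEnergy (fun x => f (z + Pi.single x 1))) := by
    intro z hz
    rw [mem_massFinset] at hz
    refine mul_le_mul_of_nonneg_left ?_ (hπ z)
    exact multiscale_energy_bound hα hb hc (hdens z) (by linarith)
      (fun x => f (z + Pi.single x 1))
  -- The time acceleration `N ^ 2` cancels the squared block length, so `4 * d ^ 2 * c` is free of
  -- `N`.
  rw [sum_equilibrium_mul_gen hα hc ha]
  refine step1.trans ?_
  rw [step2]
  calc _ ≤ a ^ α * ∑ z ∈ massFinset d N hc (m - c), equilibrium α c a z *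
          ((d * N) ^ 2 * torusEnergy (fun x => f (z + Pi.single x 1))) := by
        have : 0 ≤ a ^ α := by positivity
        exact mul_le_mul_of_nonneg_left (Finset.sum_le_sum step3) this
    _ = _ := by
      rw [Finset.mul_sum, Finset.mul_sum, Finset.mul_sum]
      refine Finset.sum_congr rfl fun z _ => ?_
      field_simp

end QuadraticForm

/-! ### Power Young functions and their norms -/

section Orlicz

variable {d N : ℕ} [NeZero N]

lemma isStrictYoung_rpow_abs {p : ℝ} (hp : 1 < p) : IsStrictYoung fun u : ℝ => |u| ^ p where
  nonneg u := by positivity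
  convex := by
    have h1 : ConvexOn ℝ Set.univ (fun u : ℝ => |u|) := convexOn_norm convex_univ
    have h2 : ConvexOn ℝ ((fun u : ℝ => |u|) '' Set.univ) (fun u : ℝ => u ^ p) := by
      have hr : (fun u : ℝ => |u|) '' Set.univ = Set.Ici 0 := by
        ext u
        simp only [Set.image_univ, Set.mem_range, Set.mem_Ici]
        exact ⟨fun ⟨v, hv⟩ => hv ▸ abs_nonneg v, fun hu => ⟨u, abs_of_nonneg hu⟩⟩
      rw [hr]
      exact convexOn_rpow hp.le
    refine h2.comp h1 ?_
    rintro _ ⟨u, -, rfl⟩ _ ⟨v, -, rfl⟩ huv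
    exact Real.rpow_le_rpow (abs_nonneg u) huv (by linarith)
  even u := by rw [abs_neg]
  lsc := (continuous_abs.rpow_const fun _ => Or.inr (by linarith)).lowerSemicontinuous
  zero := by simp [Real.zero_rpow (show p ≠ 0 by linarith)]
  superlinear := by
    refine (tendsto_rpow_atTop (show 0 < p - 1 by linarith)).congr' ?_
    filter_upwards [eventually_gt_atTop 0] with u hu
    rw [abs_of_pos hu, Real.rpow_sub_one hu.ne']

/-- A small multiple of the `p`-th moment plus a constant bounds the `p`-norm. -/
lemma orliczNorm_rpow_le {p : ℝ} (hp : 1 < p) {ε : ℝ} (hε : 0 < ε) (h : Site d N → ℝ) :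
    orliczNorm (fun u => |u| ^ p) h ≤
      ε * (1 / (N : ℝ) ^ d * ∑ x, |h x| ^ p) + (1 / ε) ^ (1 / (p - 1)) := by
  set Y : ℝ := 1 / (N : ℝ) ^ d * ∑ x, |h x| ^ p with hY
  set K : ℝ := (1 / ε) ^ (1 / (p - 1)) with hK
  have hY0 : 0 ≤ Y := by positivity
  have hK0 : 0 < K := by positivity
  have ht : 0 < ε * Y + K := by positivity
  refine csInf_le ⟨0, fun t ht => ht.1.le⟩ ⟨ht, ?_⟩
  have h1 : ∀ x, |h x / (ε * Y + K)| ^ p = |h x| ^ p / (ε * Y + K) ^ p := by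
    intro x
    rw [abs_div, abs_of_pos ht, Real.div_rpow (abs_nonneg _) ht.le]
  simp_rw [h1]
  rw [← Finset.sum_div, ← mul_div_assoc, ← hY, div_le_one (by positivity)]
  -- With `t = ε * Y + K`, this choice of `K` gives `Y = K ^ (p - 1) * (ε * Y) ≤ t ^ p`, so `t` is
  -- admissible in the infimum.
  have hKp : K ^ (p - 1) = 1 / ε := by
    rw [hK, ← Real.rpow_mul (by positivity), one_div_mul_cancel (by linarith), Real.rpow_one]
  calc Y = K ^ (p - 1) * (ε * Y) := by rw [hKp]; field_simp
    _ ≤ (ε * Y + K) ^ (p - 1) * (ε * Y + K) := by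
      have : 0 ≤ ε * Y := by positivity
      gcongr <;> linarith
    _ = (ε * Y + K) ^ p := by
      rw [Real.rpow_sub_one ht.ne']
      field_simp

end Orlicz

/-! ### Quadratic form of the generator perturbed by the norm -/

section Potential

variable {d N : ℕ} [NeZero N] {α c a b : ℝ}

/-- The exponent of the Young function. -/
def youngExponent (d : ℕ) (α : ℝ) : ℝ := 1 + gainExponent d α / α

lemma one_lt_youngExponent (d : ℕ) (hα : 0 < α) : 1 < youngExponent d α := by
  have := gainExponent_pos d hα
  have : 0 < gainExponent d α / α := by positivity
  unfold youngExponent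
  linarith

/-- The largest eigenvalue of the generator perturbed by the Orlicz norm is of order `N ^ d / c`. -/
lemma exists_perturbed_form_bound (hd : 1 ≤ d) (hα : 0 < α) (hb : 0 < b) :
    ∃ C : ℝ, ∀ (N : ℕ) [NeZero N] (c a : ℝ) (hc : 0 < c), c ≤ 1 → 0 < a →
      ∀ f : Config d N → ℝ,
        ∑ k ∈ massFinset d N hc (b * (N : ℝ) ^ d), equilibrium α c a k * f k *
            (gen α c f k + (N : ℝ) ^ d / c *
              orliczNorm (fun u => |u| ^ youngExponent d α) (fun x => density c k x ^ α) * f k)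
          ≤ C * ((N : ℝ) ^ d / c) *
            ∑ k ∈ massFinset d N hc (b * (N : ℝ) ^ d), equilibrium α c a k * f k ^ 2 := by
  set p := youngExponent d α with hp
  have hp1 := one_lt_youngExponent d hα
  set c₁ : ℝ := 1 / 8 / threshold d α b 0 ^ gainExponent d α with hc₁
  set C₁ : ℝ := 1 + threshold d α b 0 ^ α with hC₁
  have hM := threshold_pos (d := d) hα hb 0
  have hc₁0 : 0 < c₁ := by positivity
  have hd0 : (0 : ℝ) < d := by exact_mod_cast hd
  -- With this `ε` the moment in the bound for the norm has exactly the coefficient that the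
  -- Dirichlet form absorbs.
  set ε : ℝ := c₁ / (4 * d ^ 2) with hε
  have hε0 : 0 < ε := by positivity
  refine ⟨C₁ / (4 * d ^ 2) + (1 / ε) ^ (1 / (p - 1)), fun N _ c a hc hc1 ha f => ?_⟩
  have hN : (0 : ℝ) < (N : ℝ) ^ d := by
    have := NeZero.pos N
    positivity
  have hmain := sum_power_le_dirichlet hd hα hb hc hc1 ha f
  rw [← hc₁, ← hC₁] at hmain
  have hV : ∀ k : Config d N,
      (N : ℝ) ^ d / c * orliczNorm (fun u => |u| ^ p) (fun x => density c k x ^ α) ≤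
      1 / (4 * d ^ 2 * c) *
        ∑ x, (c₁ * density c k x ^ (α + gainExponent d α) - C₁)
      + (C₁ / (4 * d ^ 2) + (1 / ε) ^ (1 / (p - 1))) * ((N : ℝ) ^ d / c) := by
    intro k
    have h1 := orliczNorm_rpow_le (hp ▸ hp1) hε0 (fun x => density c k x ^ α)
    have h2 : ∀ x, |density c k x ^ α| ^ p = density c k x ^ (α + gainExponent d α) := by
      intro x
      have hx : 0 ≤ density c k x := by unfold density; positivity
      rw [abs_of_nonneg (by positivity), ← Real.rpow_mul hx, hp, youngExponent]
      congr 1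
      field_simp
    simp_rw [h2] at h1
    have hcard : (Fintype.card (Site d N) : ℝ) = (N : ℝ) ^ d := by
      simp [ZMod.card]
    have h3 : ∑ x, (c₁ * density c k x ^ (α + gainExponent d α) - C₁)
        = c₁ * ∑ x, density c k x ^ (α + gainExponent d α) - C₁ * (N : ℝ) ^ d := by
      rw [Finset.sum_sub_distrib, ← Finset.mul_sum, Finset.sum_const, Finset.card_univ,
        nsmul_eq_mul, hcard, mul_comm C₁]
    rw [h3]
    calc _ ≤ (N : ℝ) ^ d / c * (ε * (1 / (N : ℝ) ^ d *
          ∑ x, density c k x ^ (α + gainExponent d α)) + (1 / ε) ^ (1 / (p - 1))) := by gcongr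
      _ = _ := by
        generalize (1 / ε) ^ (1 / (p - 1)) = K
        rw [hε]
        field_simp
        ring
  have hπ := fun k : Config d N => equilibrium_nonneg (α := α) hc ha k
  calc _ = ∑ k ∈ massFinset d N hc (b * (N : ℝ) ^ d), equilibrium α c a k * f k * gen α c f k
        + ∑ k ∈ massFinset d N hc (b * (N : ℝ) ^ d), equilibrium α c a k * f k ^ 2 *
          ((N : ℝ) ^ d / c * orliczNorm (fun u => |u| ^ p) (fun x => density c k x ^ α)) := by
        rw [← Finset.sum_add_distrib]
        refine Finset.sum_congr rfl fun k _ => ?_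
        ring
    _ ≤ ∑ k ∈ massFinset d N hc (b * (N : ℝ) ^ d), equilibrium α c a k * f k * gen α c f k
        + ∑ k ∈ massFinset d N hc (b * (N : ℝ) ^ d), equilibrium α c a k * f k ^ 2 *
          (1 / (4 * d ^ 2 * c) *
            ∑ x, (c₁ * density c k x ^ (α + gainExponent d α) - C₁)
            + (C₁ / (4 * d ^ 2) + (1 / ε) ^ (1 / (p - 1))) * ((N : ℝ) ^ d / c)) := by
        gcongr with k _
        · have := hπ k
          positivity
        · exact hV k
    _ = ∑ k ∈ massFinset d N hc (b * (N : ℝ) ^ d), equilibrium α c a k * f k * gen α c f k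
        + 1 / (4 * d ^ 2 * c) * ∑ k ∈ massFinset d N hc (b * (N : ℝ) ^ d),
          equilibrium α c a k * f k ^ 2 *
            ∑ x, (c₁ * density c k x ^ (α + gainExponent d α) - C₁)
        + (C₁ / (4 * d ^ 2) + (1 / ε) ^ (1 / (p - 1))) * ((N : ℝ) ^ d / c) *
          ∑ k ∈ massFinset d N hc (b * (N : ℝ) ^ d), equilibrium α c a k * f k ^ 2 := by
        rw [add_assoc]
        congr 1
        rw [Finset.mul_sum, Finset.mul_sum, ← Finset.sum_add_distrib]
        refine Finset.sum_congr rfl fun k _ => ?_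
        ring
    _ ≤ _ := by
        have h : 1 / (4 * d ^ 2 * c) * ∑ k ∈ massFinset d N hc (b * (N : ℝ) ^ d),
          equilibrium α c a k * f k ^ 2 *
            ∑ x, (c₁ * density c k x ^ (α + gainExponent d α) - C₁)
          ≤ 1 / (4 * d ^ 2 * c) * (-(4 * d ^ 2 * c) *
            ∑ k ∈ massFinset d N hc (b * (N : ℝ) ^ d),
              equilibrium α c a k * f k * gen α c f k) := by gcongr
        have h' : ∀ S : ℝ, 1 / (4 * d ^ 2 * c) * (-(4 * d ^ 2 * c) * S) = -S := by
          intro S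
          field_simp
        rw [h'] at h
        linarith

end Potential

/-! ### Discrete Feynman–Kac bound for matrices -/

section FeynmanKac

variable {ι : Type*} [Fintype ι]

/-- Reduces weighted inner products to Gram matrices, whose finitely many entries can be
differentiated uniformly in `f`. -/
lemma sum_mul_sum_mul_mulVec (p f : ι → ℝ) (X Y : Matrix ι ι ℝ) :
    ∑ k, ∑ l, f k * f l * ∑ j, p j * (X j k * Y j l)
      = ∑ j, p j * (X.mulVec f j * Y.mulVec f j) := by
  simp_rw [Matrix.mulVec, dotProduct, Finset.sum_mul_sum, Finset.mul_sum]
  refine (Finset.sum_congr rfl fun k _ => Finset.sum_comm).trans ?_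
  rw [Finset.sum_comm]
  refine Finset.sum_congr rfl fun j _ => Finset.sum_congr rfl fun k _ =>
    Finset.sum_congr rfl fun l _ => ?_
  ring

variable [DecidableEq ι]

/-- One step of the chain with transition matrix `P h`, weighted by `exp (h V)`. -/
def weightedStep (P : ℝ → Matrix ι ι ℝ) (V : ι → ℝ) (h : ℝ) : Matrix ι ι ℝ :=
  Matrix.of fun k l => P h k l * Real.exp (h * V l)

/-- Short-time growth of the weighted `ℓ²` norm under a weighted step. -/
lemma eventually_weightedStep_norm_le {p : ι → ℝ} (hp : ∀ k, 0 < p k) {A : Matrix ι ι ℝ}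
    {P : ℝ → Matrix ι ι ℝ} (hP0 : P 0 = 1) (hP : ∀ k l, HasDerivAt (fun h => P h k l) (A k l) 0)
    {V : ι → ℝ} {L : ℝ}
    (hL : ∀ f : ι → ℝ, ∑ k, p k * f k * (A.mulVec f k + V k * f k) ≤ L * ∑ k, p k * f k ^ 2) :
    ∀ᶠ h in 𝓝[>] (0 : ℝ), ∀ f : ι → ℝ,
      ∑ k, p k * ((weightedStep P V h).mulVec f k) ^ 2
        ≤ Real.exp (h * (2 * L + 2)) * ∑ k, p k * f k ^ 2 := by
  set Q := weightedStep P V with hQ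
  set B : Matrix ι ι ℝ := A + Matrix.diagonal V with hB
  have hQ0 : Q 0 = 1 := by
    ext k l
    simp [hQ, weightedStep, hP0]
  have hQd : ∀ k l, HasDerivAt (fun h => Q h k l) (B k l) 0 := by
    intro k l
    have h1 : HasDerivAt (fun h : ℝ => Real.exp (h * V l)) (V l) 0 := by
      simpa using ((hasDerivAt_id (0 : ℝ)).mul_const (V l)).exp
    have h2 := (hP k l).mul h1
    refine h2.congr_deriv ?_
    rw [hP0, hB, Matrix.add_apply, Matrix.diagonal_apply, Matrix.one_apply]
    split_ifs with hkl
    · simp [hkl]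
    · simp
  set W : ℝ → ι → ι → ℝ := fun h k l => ∑ j, p j * (Q h j k * Q h j l) with hW
  have hWd : ∀ k l, HasDerivAt (fun h => W h k l)
      (∑ j, p j * (B j k * (1 : Matrix ι ι ℝ) j l)
        + ∑ j, p j * ((1 : Matrix ι ι ℝ) j k * B j l)) 0 := by
    intro k l
    have h1 : HasDerivAt (fun h => W h k l) (∑ j, p j * (B j k * Q 0 j l + Q 0 j k * B j l)) 0 :=
      HasDerivAt.fun_sum fun j _ => ((hQd j k).mul (hQd j l)).const_mul (p j)
    refine h1.congr_deriv ?_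
    rw [← Finset.sum_add_distrib, hQ0]
    exact Finset.sum_congr rfl fun j _ => by ring
  -- The tolerance is chosen so that the first-order errors, summed over all pairs, cost at most `h`
  -- times the weighted norm.
  have hsmall : ∀ᶠ h in 𝓝 (0 : ℝ), ∀ k l, |W h k l - W 0 k l
      - h * (∑ j, p j * (B j k * (1 : Matrix ι ι ℝ) j l)
        + ∑ j, p j * ((1 : Matrix ι ι ℝ) j k * B j l))|
      ≤ min (p k) (p l) / (Fintype.card ι + 1) * |h| := by
    rw [eventually_all]
    intro k
    rw [eventually_all]
    intro l
    have h1 := (hasDerivAt_iff_isLittleO_nhds_zero.1 (hWd k l)).def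
      (c := min (p k) (p l) / (Fintype.card ι + 1))
      (div_pos (lt_min (hp k) (hp l)) (by positivity))
    simpa using h1
  filter_upwards [nhdsWithin_le_nhds hsmall, self_mem_nhdsWithin] with h hh hpos f
  have hpos' : (0 : ℝ) < h := hpos
  rw [abs_of_pos hpos'] at hh
  have hS0 : 0 ≤ ∑ k, p k * f k ^ 2 :=
    Finset.sum_nonneg fun k _ => mul_nonneg (hp k).le (sq_nonneg _)
  have e1 : ∑ k, p k * ((Q h).mulVec f k) ^ 2 = ∑ k, ∑ l, f k * f l * W h k l := by
    rw [hW, sum_mul_sum_mul_mulVec]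
    exact Finset.sum_congr rfl fun k _ => by ring
  have e2 : ∑ k, ∑ l, f k * f l * W 0 k l = ∑ k, p k * f k ^ 2 := by
    simp only [hW]
    rw [sum_mul_sum_mul_mulVec, hQ0, Matrix.one_mulVec]
    exact Finset.sum_congr rfl fun k _ => by ring
  have e3 : ∑ k, ∑ l, f k * f l * (∑ j, p j * (B j k * (1 : Matrix ι ι ℝ) j l)
        + ∑ j, p j * ((1 : Matrix ι ι ℝ) j k * B j l))
      ≤ 2 * (L * ∑ k, p k * f k ^ 2) := by
    simp_rw [mul_add, Finset.sum_add_distrib]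
    rw [sum_mul_sum_mul_mulVec p f B 1, sum_mul_sum_mul_mulVec p f 1 B, Matrix.one_mulVec]
    have := hL f
    have h2 : ∑ k, p k * f k * (A.mulVec f k + V k * f k) = ∑ k, p k * (B.mulVec f k * f k) := by
      refine Finset.sum_congr rfl fun k _ => ?_
      rw [hB, Matrix.add_mulVec, Pi.add_apply, Matrix.mulVec_diagonal]
      ring
    have h3 : ∑ k, p k * (f k * B.mulVec f k) = ∑ k, p k * (B.mulVec f k * f k) :=
      Finset.sum_congr rfl fun k _ => by ring
    linarith
  have e4 : ∑ k, ∑ l, f k * f l * (W h k l - W 0 k l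
      - h * (∑ j, p j * (B j k * (1 : Matrix ι ι ℝ) j l)
        + ∑ j, p j * ((1 : Matrix ι ι ℝ) j k * B j l))) ≤ h * ∑ k, p k * f k ^ 2 := by
    have h1 : ∀ k l, f k * f l * (W h k l - W 0 k l
      - h * (∑ j, p j * (B j k * (1 : Matrix ι ι ℝ) j l)
        + ∑ j, p j * ((1 : Matrix ι ι ℝ) j k * B j l)))
        ≤ h / (Fintype.card ι + 1) * ((p k * f k ^ 2 + p l * f l ^ 2) / 2) := by
      intro k l
      have hm : 0 < min (p k) (p l) := lt_min (hp k) (hp l)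
      have h2 : |f k * f l| ≤ (f k ^ 2 + f l ^ 2) / 2 := by
        rw [abs_mul]
        nlinarith [sq_nonneg (|f k| - |f l|), sq_abs (f k), sq_abs (f l)]
      calc _ ≤ |f k * f l| * |W h k l - W 0 k l
            - h * (∑ j, p j * (B j k * (1 : Matrix ι ι ℝ) j l)
              + ∑ j, p j * ((1 : Matrix ι ι ℝ) j k * B j l))| := by
            rw [← abs_mul]
            exact le_abs_self _
        _ ≤ (f k ^ 2 + f l ^ 2) / 2 * (min (p k) (p l) / (Fintype.card ι + 1) * h) := by
            gcongr
            exact hh k l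
        _ = h / (Fintype.card ι + 1) *
            ((min (p k) (p l) * f k ^ 2 + min (p k) (p l) * f l ^ 2) / 2) := by ring
        _ ≤ _ := by
            gcongr
            · exact min_le_left _ _
            · exact min_le_right _ _
    refine (Finset.sum_le_sum fun k _ => Finset.sum_le_sum fun l _ => h1 k l).trans ?_
    simp_rw [← Finset.mul_sum, ← Finset.sum_div, Finset.sum_add_distrib, Finset.sum_const,
      Finset.card_univ, nsmul_eq_mul, ← Finset.mul_sum]
    have h2 : h / (Fintype.card ι + 1) * ((Fintype.card ι * ∑ k, p k * f k ^ 2 +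
        Fintype.card ι * ∑ k, p k * f k ^ 2) / 2)
        = h * ∑ k, p k * f k ^ 2 * (Fintype.card ι / (Fintype.card ι + 1)) := by
      rw [← Finset.sum_mul]
      field_simp
      ring
    rw [h2, ← Finset.sum_mul]
    have h3 : (Fintype.card ι : ℝ) / (Fintype.card ι + 1) ≤ 1 := by
      rw [div_le_one (by positivity)]
      linarith
    exact mul_le_mul_of_nonneg_left (mul_le_of_le_one_right hS0 h3) hpos'.le
  have e5 : ∑ k, ∑ l, f k * f l * W h k l
      = ∑ k, ∑ l, f k * f l * W 0 k l
        + h * ∑ k, ∑ l, f k * f l * (∑ j, p j * (B j k * (1 : Matrix ι ι ℝ) j l)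
        + ∑ j, p j * ((1 : Matrix ι ι ℝ) j k * B j l))
        + ∑ k, ∑ l, f k * f l * (W h k l - W 0 k l
      - h * (∑ j, p j * (B j k * (1 : Matrix ι ι ℝ) j l)
        + ∑ j, p j * ((1 : Matrix ι ι ℝ) j k * B j l))) := by
    rw [Finset.mul_sum, ← Finset.sum_add_distrib, ← Finset.sum_add_distrib]
    refine Finset.sum_congr rfl fun k _ => ?_
    rw [Finset.mul_sum, ← Finset.sum_add_distrib, ← Finset.sum_add_distrib]
    exact Finset.sum_congr rfl fun l _ => by ring
  rw [e1, e5, e2]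
  have h6 : h * ∑ k, ∑ l, f k * f l * (∑ j, p j * (B j k * (1 : Matrix ι ι ℝ) j l)
        + ∑ j, p j * ((1 : Matrix ι ι ℝ) j k * B j l))
      ≤ h * (2 * (L * ∑ k, p k * f k ^ 2)) := mul_le_mul_of_nonneg_left e3 hpos'.le
  have h7 : (h * (2 * L + 2) + 1) * ∑ k, p k * f k ^ 2
      ≤ Real.exp (h * (2 * L + 2)) * ∑ k, p k * f k ^ 2 :=
    mul_le_mul_of_nonneg_right (Real.add_one_le_exp _) hS0
  -- The expansion gives the rate `2 * L + 1`; one more unit is discarded so that the final exponent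
  -- is twice `L + 1`.
  have h8 : 0 ≤ h * ∑ k, p k * f k ^ 2 := mul_nonneg hpos'.le hS0
  linarith

/-- The discretised Feynman–Kac functional is bounded through the top of the spectrum. -/
lemma eventually_sum_weightedStep_pow_le {p : ι → ℝ} (hp : ∀ k, 0 < p k) {A : Matrix ι ι ℝ}
    {P : ℝ → Matrix ι ι ℝ} (hP0 : P 0 = 1) (hP : ∀ k l, HasDerivAt (fun h => P h k l) (A k l) 0)
    {V : ι → ℝ} {L : ℝ}
    (hL : ∀ f : ι → ℝ, ∑ k, p k * f k * (A.mulVec f k + V k * f k) ≤ L * ∑ k, p k * f k ^ 2)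
    {T : ℝ} (hT : 0 < T) :
    ∀ᶠ n : ℕ in atTop, ∑ k, p k * ((weightedStep P V (T / n)) ^ n).mulVec (fun _ => 1) k
      ≤ (∑ k, p k) * Real.exp (T * (L + 1)) := by
  have ht : Tendsto (fun n : ℕ => T / n) atTop (𝓝[>] 0) := by
    refine tendsto_nhdsWithin_iff.2 ⟨tendsto_const_div_atTop_nhds_zero_nat T, ?_⟩
    filter_upwards [eventually_gt_atTop 0] with n hn
    have : (0 : ℝ) < n := by exact_mod_cast hn
    exact div_pos hT this
  filter_upwards [ht.eventually (eventually_weightedStep_norm_le hp hP0 hP hL),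
    eventually_gt_atTop 0] with n hn hn0
  set Q := weightedStep P V (T / n)
  have hpow : ∀ m : ℕ, ∑ k, p k * ((Q ^ m).mulVec (fun _ => 1) k) ^ 2
      ≤ Real.exp (T / n * (2 * L + 2)) ^ m * ∑ k, p k := by
    intro m
    induction m with
    | zero => simp
    | succ m ih =>
      rw [pow_succ', ← Matrix.mulVec_mulVec]
      refine (hn _).trans ?_
      rw [pow_succ', mul_assoc]
      gcongr
  have hn0' : (n : ℝ) ≠ 0 := by exact_mod_cast hn0.ne'
  have hn2 := hpow n
  rw [← Real.exp_nat_mul, show (n : ℝ) * (T / n * (2 * L + 2)) = T * (L + 1) + T * (L + 1) by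
    field_simp; ring, Real.exp_add] at hn2
  have hS : 0 ≤ ∑ k, p k := Finset.sum_nonneg fun k _ => (hp k).le
  refine le_of_sq_le_sq ?_ (by positivity)
  -- Cauchy–Schwarz against the constant function converts the `ℓ²` growth into the desired
  -- expectation.
  have hcs : (∑ k, p k * (Q ^ n).mulVec (fun _ => 1) k) ^ 2
      ≤ (∑ k, p k) * ∑ k, p k * ((Q ^ n).mulVec (fun _ => 1) k) ^ 2 := by
    refine Finset.sum_sq_le_sum_mul_sum_of_sq_le_mul _ (fun k _ => (hp k).le)
      (fun k _ => mul_nonneg (hp k).le (sq_nonneg _)) fun k _ => le_of_eq ?_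
    ring
  calc _ ≤ (∑ k, p k) * (Real.exp (T * (L + 1)) * Real.exp (T * (L + 1)) * ∑ k, p k) :=
        hcs.trans (mul_le_mul_of_nonneg_left hn2 hS)
    _ = _ := by ring

/-- Summation over paths is a power of the transition matrix. -/
lemma sum_paths_eq_pow (Q : Matrix ι ι ℝ) (n : ℕ) (p : ι → ℝ) :
    ∑ w : Fin (n + 1) → ι, p (w 0) * ∏ i : Fin n, Q (w i.castSucc) (w i.succ)
      = ∑ k, p k * (Q ^ n).mulVec (fun _ => 1) k := by
  induction n generalizing p with
  | zero =>
    rw [← Equiv.sum_comp (Equiv.funUnique (Fin 1) ι).symm]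
    simp
  | succ n ih =>
    rw [← Equiv.sum_comp (Fin.consEquiv fun _ => ι), Fintype.sum_prod_type]
    simp only [Fin.consEquiv, Equiv.coe_fn_mk, Fin.prod_univ_succ, Fin.cons_zero,
      Fin.castSucc_zero, Fin.cons_succ, Fin.castSucc_succ]
    rw [Finset.sum_comm]
    have h1 : ∀ w : Fin (n + 1) → ι,
        ∑ a, p a * (Q a (w 0) * ∏ i : Fin n, Q (w i.castSucc) (w i.succ))
        = (∑ a, p a * Q a (w 0)) * ∏ i : Fin n, Q (w i.castSucc) (w i.succ) := by
      intro w
      rw [Finset.sum_mul]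
      exact Finset.sum_congr rfl fun a _ => by ring
    simp_rw [h1]
    rw [ih fun b => ∑ a, p a * Q a b]
    simp_rw [pow_succ', ← Matrix.mulVec_mulVec]
    simp_rw [Finset.sum_mul]
    rw [Finset.sum_comm]
    refine Finset.sum_congr rfl fun a _ => ?_
    rw [Matrix.mulVec, dotProduct, Finset.mul_sum]
    exact Finset.sum_congr rfl fun b _ => by ring

end FeynmanKac

/-! ### Entries of matrix exponentials -/

section MatrixExp

open scoped Matrix.Norms.Operator

variable {ι : Type*} [Fintype ι] [DecidableEq ι]

lemma hasSum_exp_smul_apply (A : Matrix ι ι ℝ) (t : ℝ) (k l : ι) :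
    HasSum (fun n : ℕ => t ^ n / (n.factorial : ℝ) * (A ^ n) k l)
      (NormedSpace.exp (t • A) k l) := by
  have h := NormedSpace.exp_series_hasSum_exp' (𝕂 := ℝ) (t • A)
  have h1 : HasSum (fun n : ℕ => (((n.factorial : ℝ)⁻¹) • (t • A) ^ n) k l)
      (NormedSpace.exp (t • A) k l) :=
    h.map (Matrix.entryAddMonoidHom ℝ k l) (continuous_id.matrix_elem k l)
  convert h1 using 2 with n
  rw [smul_pow, Matrix.smul_apply, Matrix.smul_apply, smul_eq_mul, smul_eq_mul]
  ring

lemma hasDerivAt_exp_smul_apply_zero (A : Matrix ι ι ℝ) (k l : ι) :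
    HasDerivAt (fun t : ℝ => NormedSpace.exp (t • A) k l) (A k l) 0 := by
  have h := hasDerivAt_exp_smul_const (𝕂 := ℝ) A 0
  rw [zero_smul, NormedSpace.exp_zero, one_mul] at h
  exact hasDerivAt_pi.1 (hasDerivAt_pi.1 h k) l

/-- Adding a large multiple of the identity makes all entries nonnegative, hence also the
exponential series. The multiple commutes with everything and only contributes a positive scalar
factor. -/
lemma exp_smul_apply_nonneg {A : Matrix ι ι ℝ} (hA : ∀ k l, k ≠ l → 0 ≤ A k l) {t : ℝ}
    (ht : 0 ≤ t) (k l : ι) : 0 ≤ NormedSpace.exp (t • A) k l := by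
  set R : ℝ := ∑ k, |A k k| with hR
  set B : Matrix ι ι ℝ := A + R • 1 with hB
  have hB0 : ∀ i j, 0 ≤ B i j := by
    intro i j
    rw [hB, Matrix.add_apply, Matrix.smul_apply, Matrix.one_apply]
    by_cases h : i = j
    · subst h
      have h1 : |A i i| ≤ R :=
        Finset.single_le_sum (f := fun i => |A i i|) (fun _ _ => abs_nonneg _) (Finset.mem_univ i)
      have h2 := neg_abs_le (A i i)
      simp only [if_true, smul_eq_mul, mul_one]
      linarith
    · simpa [h] using hA i j h
  have hBn : ∀ (n : ℕ) i j, 0 ≤ (B ^ n) i j := by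
    intro n
    induction n with
    | zero =>
      intro i j
      rw [pow_zero, Matrix.one_apply]
      split_ifs <;> norm_num
    | succ n ih =>
      intro i j
      rw [pow_succ, Matrix.mul_apply]
      exact Finset.sum_nonneg fun m _ => mul_nonneg (ih i m) (hB0 m j)
  have hBe : 0 ≤ NormedSpace.exp (t • B) k l :=
    (hasSum_exp_smul_apply B t k l).nonneg fun n => mul_nonneg (by positivity) (hBn n k l)
  have hsplit : t • A = t • B + Matrix.diagonal (fun _ => -(t * R)) := by
    ext i j
    rw [hB]
    simp only [Matrix.smul_apply, Matrix.add_apply, Matrix.one_apply, Matrix.diagonal_apply,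
      smul_eq_mul]
    split_ifs <;> ring
  have hcomm : Commute (t • B) (Matrix.diagonal (fun _ => -(t * R))) := by
    rw [← Matrix.smul_one_eq_diagonal]
    exact (Commute.one_right _).smul_right _
  rw [hsplit, Matrix.exp_add_of_commute _ _ hcomm, Matrix.exp_diagonal, Matrix.mul_diagonal]
  refine mul_nonneg hBe ?_
  rw [Pi.coe_exp, ← Real.exp_eq_exp_ℝ]
  exact (Real.exp_pos _).le

end MatrixExp

/-! ### The generator as a finite matrix, and positivity of the equilibrium -/

section Generator

variable {d N : ℕ} [NeZero N] {α c a b : ℝ}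

open Classical in
/-- The indicator function of a configuration. -/
def indicatorAt (l : Config d N) : Config d N → ℝ := fun k => if k = l then 1 else 0

/-- Jumps preserve the mass. The exception is `move` from an empty site, where truncated subtraction
creates a particle, but there the rate is zero. -/
lemma gen_congr (hα : 0 < α) {F G : Config d N → ℝ} {k : Config d N}
    (h : ∀ l : Config d N, ∑ x, density c l x = ∑ x, density c k x → F l = G l) :
    gen α c F k = gen α c G k := by
  classical
  unfold gen
  congr 2
  refine Finset.sum_congr rfl fun x _ => Finset.sum_congr rfl fun y _ => ?_
  split_ifs
  · by_cases hx : k x = 0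
    · simp [density, hx, Real.zero_rpow hα.ne']
    · rw [h k rfl, h (move k x y) (sum_density_move hx)]
  · rfl

lemma gen_sum {κ : Type*} (s : Finset κ) (F : κ → Config d N → ℝ) (w : κ → ℝ) (k : Config d N) :
    gen α c (fun l => ∑ i ∈ s, w i * F i l) k = ∑ i ∈ s, gen α c (F i) k * w i := by
  classical
  have h : ∀ G : Config d N → ℝ, gen α c G k = ∑ x, ∑ y, (N : ℝ) ^ 2 * ((1 / 2) *
      if Adj x y then density c k x ^ α / c * (G (move k x y) - G k) else 0) := by
    intro G
    simp only [gen, Finset.mul_sum]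
  simp only [h, Finset.sum_mul]
  conv_rhs => rw [Finset.sum_comm]
  refine Finset.sum_congr rfl fun x _ => ?_
  conv_rhs => rw [Finset.sum_comm]
  refine Finset.sum_congr rfl fun y _ => ?_
  split_ifs
  · rw [← Finset.sum_sub_distrib, Finset.mul_sum, Finset.mul_sum, Finset.mul_sum]
    exact Finset.sum_congr rfl fun i _ => by ring
  · simp

/-- The matrix of the generator on the configurations of bounded mass. -/
def genMatrix (α : ℝ) (hc : 0 < c) (m : ℝ) :
    Matrix (massFinset d N hc m) (massFinset d N hc m) ℝ :=
  Matrix.of fun k l => gen α c (indicatorAt l.1) k.1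

lemma gen_eq_mulVec (hα : 0 < α) (hc : 0 < c) (m : ℝ) (F : Config d N → ℝ)
    (k : massFinset d N hc m) :
    gen α c F k.1 = (genMatrix α hc m).mulVec (fun l => F l.1) k := by
  classical
  rw [gen_congr hα (G := fun l => ∑ i : massFinset d N hc m, F i.1 * indicatorAt i.1 l), gen_sum]
  · rfl
  · intro l hl
    have hmem : l ∈ massFinset d N hc m := by
      rw [mem_massFinset, hl]
      exact (mem_massFinset hc).1 k.2
    rw [Finset.sum_eq_single (⟨l, hmem⟩ : massFinset d N hc m)]
    · simp [indicatorAt]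
    · intro i _ hi
      have : l ≠ i.1 := fun h => hi (Subtype.ext h.symm)
      simp [indicatorAt, this]
    · simp

lemma gen_iterate_eq_mulVec (hα : 0 < α) (hc : 0 < c) (m : ℝ) (F : Config d N → ℝ) (n : ℕ)
    (k : massFinset d N hc m) :
    (gen α c)^[n] F k.1 = ((genMatrix α hc m) ^ n).mulVec (fun l => F l.1) k := by
  classical
  induction n generalizing k with
  | zero => simp
  | succ n ih =>
    rw [Function.iterate_succ_apply', gen_eq_mulVec hα hc m, pow_succ', ← Matrix.mulVec_mulVec]
    congr 1
    funext l
    exact ih l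

/-- By conservation of mass the iterates of the generator on this finite set are powers of one
matrix, which gives access to derivatives at time zero and to positivity. -/
lemma transition_eq_exp (hα : 0 < α) (hc : 0 < c) (m t : ℝ) (k l : massFinset d N hc m) :
    transition α c t k.1 l.1 = open Classical in NormedSpace.exp (t • genMatrix α hc m) k l := by
  classical
  have h : ∀ n : ℕ, (gen α c)^[n] (indicatorAt l.1) k.1 = ((genMatrix α hc m) ^ n) k l := by
    intro n
    rw [gen_iterate_eq_mulVec hα hc m]
    have : (fun l' : massFinset d N hc m => indicatorAt l.1 l'.1) = Pi.single l 1 := by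
      funext l'
      simp only [indicatorAt, Pi.single_apply, Subtype.ext_iff]
    rw [this, Matrix.mulVec_single_one, Matrix.col_apply]
  rw [← (hasSum_exp_smul_apply (genMatrix α hc m) t k l).tsum_eq]
  refine tsum_congr fun n => ?_
  rw [← h]
  rfl

lemma genMatrix_nonneg (hc : 0 < c) (m : ℝ) {k l : massFinset d N hc m} (hkl : k ≠ l) :
    0 ≤ genMatrix α hc m k l := by
  have h : k.1 ≠ l.1 := fun h => hkl (Subtype.ext h)
  simp only [genMatrix, Matrix.of_apply, gen, indicatorAt, h, if_false, sub_zero]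
  have hd : ∀ x, 0 ≤ density c k.1 x := fun x => by unfold density; positivity
  refine mul_nonneg (by positivity) (mul_nonneg (by norm_num)
    (Finset.sum_nonneg fun x _ => Finset.sum_nonneg fun y _ => ?_))
  have := hd x
  split_ifs <;> positivity

lemma transition_nonneg (hα : 0 < α) (hc : 0 < c) {m t : ℝ} (ht : 0 ≤ t)
    (k l : massFinset d N hc m) : 0 ≤ transition α c t k.1 l.1 := by
  classical
  rw [transition_eq_exp hα]
  exact exp_smul_apply_nonneg (fun _ _ h => genMatrix_nonneg hc m h) ht k l

lemma gen_iterate_indicatorAt_eq_zero (hα : 0 < α) (l : Config d N) (n : ℕ) {k : Config d N}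
    (h : ∑ x, density c k x ≠ ∑ x, density c l x) :
    (gen α c)^[n] (indicatorAt l) k = 0 := by
  induction n generalizing k with
  | zero =>
    have : k ≠ l := fun hkl => h (by rw [hkl])
    simp [indicatorAt, this]
  | succ n ih =>
    rw [Function.iterate_succ_apply',
      gen_congr hα (G := fun _ => 0) fun l' hl' => ih (by rwa [hl'])]
    simp [gen]

/-- Particles are conserved. -/
lemma transition_eq_zero (hα : 0 < α) (t : ℝ) {k l : Config d N}
    (h : ∑ x, density c k x ≠ ∑ x, density c l x) : transition α c t k l = 0 := by
  have h1 := fun n => gen_iterate_indicatorAt_eq_zero hα l n h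
  unfold indicatorAt at h1
  simp [transition, h1]

/-- Positivity rests on summability, as a divergent `tsum` would be zero. The terms are `(u ^ j /
j!) ^ α`, eventually at most `u ^ j / j!` because `1 ≤ α`. -/
lemma partitionFn_pos (hα : 1 ≤ α) {u : ℝ} (hu : 0 < u) : 0 < partitionFn α u := by
  have hterm : ∀ j : ℕ, u ^ (α * (j : ℝ)) / (j.factorial : ℝ) ^ α
      = (u ^ j / (j.factorial : ℝ)) ^ α := by
    intro j
    rw [Real.div_rpow (by positivity) (by positivity), mul_comm, Real.rpow_natCast_mul hu.le]
  have hsum : Summable fun j : ℕ => u ^ (α * (j : ℝ)) / (j.factorial : ℝ) ^ α := by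
    simp_rw [hterm]
    have h1 := Real.summable_pow_div_factorial u
    refine Summable.of_norm_bounded_eventually_nat h1 ?_
    filter_upwards [h1.tendsto_atTop_zero.eventually_le_const one_pos] with j hj
    rw [Real.norm_of_nonneg (by positivity)]
    exact Real.rpow_le_self_of_le_one (by positivity) hj hα
  exact hsum.tsum_pos (fun j => by positivity) 0 (by positivity)

lemma equilibrium_pos (hα : 1 ≤ α) (hc : 0 < c) (ha : 0 < a) (k : Config d N) :
    0 < equilibrium α c a k := by
  have := partitionFn_pos hα (div_pos ha hc)
  exact Finset.prod_pos fun x _ => by positivity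

end Generator

/-! ### Riemann sums along right-continuous paths -/

section Riemann

/-- Right Riemann sums of a bounded, right-continuous, discrete-valued path converge. -/
lemma tendsto_right_riemann_sum {X : Type*} {T : ℝ} (hT : 0 < T) (g : ℝ → X) (V : X → ℝ) {C : ℝ}
    (hV : ∀ x, |V x| ≤ C) (hg : ∀ t ∈ Set.Ico 0 T, ∀ᶠ s in 𝓝[>] t, g s = g t) :
    Tendsto (fun n : ℕ => ∑ i ∈ Finset.range n, T / n * V (g ((i + 1 : ℕ) * (T / n)))) atTop
      (𝓝 (∫ s in (0 : ℝ)..T, V (g s))) := by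
  set F : ℕ → ℝ → ℝ := fun n s => V (g ((⌈s / (T / n)⌉₊ : ℕ) * (T / n))) with hF
  have hceil : ∀ n : ℕ, 0 < n → ∀ i : ℕ, ∀ s ∈ Set.Ioc ((i : ℝ) * (T / n)) ((i + 1 : ℕ) * (T / n)),
      F n s = V (g ((i + 1 : ℕ) * (T / n))) := by
    intro n hn i s hs
    have hn' : (0 : ℝ) < n := by exact_mod_cast hn
    have hh : 0 < T / n := by positivity
    have : ⌈s / (T / n)⌉₊ = i + 1 := by
      rw [Nat.ceil_eq_iff (by omega)]
      refine ⟨?_, ?_⟩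
      · rw [lt_div_iff₀ hh]
        simpa using hs.1
      · rw [div_le_iff₀ hh]
        exact hs.2
    simp only [hF, this]
  have hpiece : ∀ n : ℕ, 0 < n → ∀ i : ℕ,
      IntervalIntegrable (F n) volume ((i : ℝ) * (T / n)) ((i + 1 : ℕ) * (T / n)) ∧
      ∫ s in ((i : ℝ) * (T / n))..((i + 1 : ℕ) * (T / n)), F n s
        = T / n * V (g ((i + 1 : ℕ) * (T / n))) := by
    intro n hn i
    have hn' : (0 : ℝ) < n := by exact_mod_cast hn
    have hh : 0 < T / n := by positivity
    have hle : (i : ℝ) * (T / n) ≤ (i + 1 : ℕ) * (T / n) := by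
      gcongr
      simp
    have heq : Set.EqOn (fun _ => V (g ((i + 1 : ℕ) * (T / n)))) (F n)
        (Set.uIoc ((i : ℝ) * (T / n)) ((i + 1 : ℕ) * (T / n))) := by
      intro s hs
      rw [Set.uIoc_of_le hle] at hs
      exact (hceil n hn i s hs).symm
    refine ⟨(intervalIntegrable_const (c := V (g ((i + 1 : ℕ) * (T / n))))).congr heq, ?_⟩
    rw [intervalIntegral.integral_of_le hle, setIntegral_congr_fun measurableSet_Ioc
      fun s hs => hceil n hn i s hs]
    simp only [integral_const, MeasurableSet.univ, measureReal_restrict_apply, Set.univ_inter,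
      Real.volume_real_Ioc_of_le hle, smul_eq_mul]
    push_cast
    ring
  have hsum : ∀ n : ℕ, 0 < n → IntervalIntegrable (F n) volume 0 T ∧
      ∫ s in (0 : ℝ)..T, F n s
        = ∑ i ∈ Finset.range n, T / n * V (g ((i + 1 : ℕ) * (T / n))) := by
    intro n hn
    have hn' : (n : ℝ) ≠ 0 := by exact_mod_cast hn.ne'
    have h0 : ((0 : ℕ) : ℝ) * (T / n) = 0 := by simp
    have h1 : (n : ℝ) * (T / n) = T := by field_simp
    have hI := fun k (_ : k < n) => (hpiece n hn k).1
    have h2 := IntervalIntegrable.trans_iterate (a := fun i : ℕ => (i : ℝ) * (T / n)) hI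
    have h3 := intervalIntegral.sum_integral_adjacent_intervals
      (a := fun i : ℕ => (i : ℝ) * (T / n)) hI
    simp only [h0, h1] at h2 h3
    refine ⟨h2, ?_⟩
    rw [← h3]
    exact Finset.sum_congr rfl fun i _ => (hpiece n hn i).2
  have hlim : Tendsto (fun n => ∫ s in (0 : ℝ)..T, F n s) atTop
      (𝓝 (∫ s in (0 : ℝ)..T, V (g s))) := by
    refine intervalIntegral.tendsto_integral_filter_of_dominated_convergence (fun _ => C) ?_ ?_
      intervalIntegrable_const ?_
    · filter_upwards [eventually_gt_atTop 0] with n hn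
      exact ((hsum n hn).1.def').aestronglyMeasurable
    · exact Eventually.of_forall fun n => Eventually.of_forall fun s _ => hV _
    · refine Eventually.of_forall fun s hs => ?_
      rw [Set.uIoc_of_le hT.le] at hs
      -- The endpoint `T` is itself a grid point, so right continuity is not needed there; elsewhere
      -- the grid point following `s` tends to `s` from the right.
      rcases hs.2.eq_or_lt with rfl | hsT
      · refine tendsto_const_nhds.congr' ?_
        filter_upwards [eventually_gt_atTop 0] with n hn
        have hn' : (n : ℝ) ≠ 0 := by exact_mod_cast hn.ne'
        have h1 : s / (s / n) = n := by field_simp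
        simp only [hF, h1, Nat.ceil_natCast]
        congr 2
        field_simp
      · have hev : ∀ᶠ r in 𝓝[≥] s, g r = g s := by
          have h1 := hg s ⟨hs.1.le, hsT⟩
          rw [← Set.Ioi_insert, nhdsWithin_insert]
          exact Filter.eventually_sup.2 ⟨by simp, h1⟩
        have hgrid : Tendsto (fun n : ℕ => (⌈s / (T / n)⌉₊ : ℝ) * (T / n)) atTop (𝓝[≥] s) := by
          refine tendsto_nhdsWithin_iff.2 ⟨?_, ?_⟩
          · have hup : Tendsto (fun n : ℕ => s + T / n) atTop (𝓝 s) := by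
              simpa using (tendsto_const_div_atTop_nhds_zero_nat T).const_add s
            refine tendsto_of_tendsto_of_tendsto_of_le_of_le' tendsto_const_nhds hup ?_ ?_
            · filter_upwards [eventually_gt_atTop 0] with n hn
              have hn' : (0 : ℝ) < n := by exact_mod_cast hn
              rw [← div_le_iff₀ (by positivity)]
              exact Nat.le_ceil _
            · filter_upwards [eventually_gt_atTop 0] with n hn
              have hn' : (0 : ℝ) < n := by exact_mod_cast hn
              have hh : 0 < T / n := by positivity
              have h1 := Nat.ceil_lt_add_one (div_nonneg hs.1.le hh.le)
              calc (⌈s / (T / n)⌉₊ : ℝ) * (T / n) ≤ (s / (T / n) + 1) * (T / n) := by gcongr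
                _ = _ := by field_simp
          · filter_upwards [eventually_gt_atTop 0] with n hn
            have hn' : (0 : ℝ) < n := by exact_mod_cast hn
            rw [Set.mem_Ici, ← div_le_iff₀ (by positivity)]
            exact Nat.le_ceil _
        refine tendsto_const_nhds.congr' ?_
        filter_upwards [hgrid.eventually hev] with n hn
        simp only [hF, hn]
  refine hlim.congr' ?_
  filter_upwards [eventually_gt_atTop 0] with n hn
  exact (hsum n hn).2

end Riemann

/-! ### Exponential moments of the process -/

section ExponentialMoments

variable {d N : ℕ} [NeZero N] {α c a T : ℝ} {Ω : Type*} [MeasurableSpace Ω] {P : Measure Ω}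
  {K : ℝ → Ω → Config d N} {μ : Config d N → ℝ}

lemma IsRescaledZRP.measure_initial (hK : IsRescaledZRP α c T μ P K) (hT : 0 < T)
    (k : Config d N) : P (K 0 ⁻¹' {k}) = ENNReal.ofReal (μ k) := by
  have h := hK.finite_dim 0 (fun _ => 0) (fun _ => k) rfl monotone_const hT.le
  simpa [Set.preimage] using h

/-- The mass is conserved along the process. -/
lemma IsRescaledZRP.ae_sum_density_eq (hK : IsRescaledZRP α c T μ P K) (hα : 0 < α)
    {t : ℝ} (ht : t ∈ Set.Icc 0 T) :
    ∀ᵐ ω ∂P, ∑ x, density c (K t ω) x = ∑ x, density c (K 0 ω) x := by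
  rw [ae_iff]
  have hsub : {ω | ¬ ∑ x, density c (K t ω) x = ∑ x, density c (K 0 ω) x} ⊆
      ⋃ q : {q : Config d N × Config d N // ∑ x, density c q.1 x ≠ ∑ x, density c q.2 x},
        {ω | K 0 ω = q.1.1 ∧ K t ω = q.1.2} := by
    intro ω hω
    exact Set.mem_iUnion.2 ⟨⟨(K 0 ω, K t ω), fun h => hω h.symm⟩, rfl, rfl⟩
  refine measure_mono_null hsub (measure_iUnion_null fun q => ?_)
  have h := hK.finite_dim 1 (fun i => if i = 0 then 0 else t)
    (fun i => if i = 0 then q.1.1 else q.1.2) rfl ?_ (by simpa using ht.2)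
  · have hset : {ω | ∀ i ≤ 1, K (if i = 0 then 0 else t) ω = if i = 0 then q.1.1 else q.1.2}
        = {ω | K 0 ω = q.1.1 ∧ K t ω = q.1.2} := by
      ext ω
      simp only [Set.mem_ofPred_eq]
      refine ⟨fun h => ⟨by simpa using h 0 (by norm_num), by simpa using h 1 le_rfl⟩,
        fun h i hi => ?_⟩
      interval_cases i
      · simpa using h.1
      · simpa using h.2
    rw [hset] at h
    rw [h]
    simp [transition_eq_zero hα t q.2]
  · intro i j hij
    dsimp only
    split_ifs with h1 h2
    · exact le_rfl
    · exact ht.1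
    · omega
    · exact le_rfl

/-- The masses are probabilities of disjoint events for the initial state, so the normalisation of
the equilibrium need not be computed. -/
lemma IsRescaledZRP.sum_initial_le_one [IsProbabilityMeasure P]
    (hK : IsRescaledZRP α c T μ P K) (hT : 0 < T) (hμ : ∀ k, 0 ≤ μ k)
    (s : Finset (Config d N)) : ∑ k ∈ s, μ k ≤ 1 := by
  have h : ENNReal.ofReal (∑ k ∈ s, μ k) ≤ 1 := by
    rw [ENNReal.ofReal_sum_of_nonneg fun k _ => hμ k]
    simp_rw [← hK.measure_initial hT]
    rw [sum_measure_preimage_singleton s fun k _ =>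
      hK.measurable 0 ⟨le_rfl, hT.le⟩ (measurableSet_singleton k)]
    exact prob_le_one
  simpa using h

/-- The exponential moment of a Riemann sum, for a potential that vanishes off the
configurations of bounded mass. -/
lemma IsRescaledZRP.lintegral_exp_riemann_sum_le [IsProbabilityMeasure P]
    (hK : IsRescaledZRP α c T μ P K) (hα : 0 < α) (hc : 0 < c) (hT : 0 < T)
    (hμ : ∀ k, 0 ≤ μ k) {m : ℝ} {V : Config d N → ℝ} (hV : ∀ k ∉ massFinset d N hc m, V k = 0)
    {n : ℕ} (hn : 0 < n) :
    ∫⁻ ω, ENNReal.ofReal (Real.exp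
        (∑ i ∈ Finset.range n, T / n * V (K ((i + 1 : ℕ) * (T / n)) ω))) ∂P
      ≤ 1 + ENNReal.ofReal (open Classical in ∑ k : massFinset d N hc m, μ k.1 *
        ((weightedStep (fun t => Matrix.of fun k l : massFinset d N hc m =>
            transition α c t k.1 l.1) (fun k => V k.1) (T / n)) ^ n).mulVec (fun _ => 1) k) := by
  classical
  have hn' : (0 : ℝ) < n := by exact_mod_cast hn
  set h : ℝ := T / n with hh
  have hh0 : 0 < h := by positivity
  have htimes : ∀ i ≤ n, (i : ℝ) * h ∈ Set.Icc 0 T := by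
    intro i hi
    refine ⟨by positivity, ?_⟩
    calc (i : ℝ) * h ≤ n * h := by gcongr
      _ = T := by rw [hh]; field_simp
  set ι := massFinset d N hc m with hι
  -- `Fin.ofNat` wraps around beyond `n`, but only the indices up to `n` are used.
  set path : (Fin (n + 1) → ι) → ℕ → Config d N := fun w i => (w (Fin.ofNat (n + 1) i)).1
    with hpath
  set E : (Fin (n + 1) → ι) → Set Ω := fun w => {ω | ∀ i ≤ n, K (i * h) ω = path w i} with hE
  have hEmeas : ∀ w, MeasurableSet (E w) := by
    intro w
    have : E w = ⋂ i : ℕ, ⋂ _ : i ≤ n, K (i * h) ⁻¹' {path w i} := by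
      ext ω
      simp [hE]
    rw [this]
    exact MeasurableSet.iInter fun i => MeasurableSet.iInter fun hi =>
      hK.measurable _ (htimes i hi) (measurableSet_singleton _)
  set wt : (Fin (n + 1) → ι) → ℝ := fun w =>
    Real.exp (∑ i ∈ Finset.range n, h * V (path w (i + 1))) with hwt
  have hcons : ∀ᵐ ω ∂P, ∀ i ≤ n, ∑ x, density c (K (i * h) ω) x = ∑ x, density c (K 0 ω) x := by
    rw [ae_all_iff]
    intro i
    by_cases hi : i ≤ n
    · filter_upwards [hK.ae_sum_density_eq hα (htimes i hi)] with ω hω _ using hω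
    · exact Eventually.of_forall fun ω hi' => absurd hi' hi
  -- Paths starting above the mass bound stay there and see zero potential, which accounts for the
  -- summand `1`; the others follow one of finitely many discrete paths.
  have hpt : ∀ᵐ ω ∂P, ENNReal.ofReal (Real.exp
        (∑ i ∈ Finset.range n, h * V (K ((i + 1 : ℕ) * h) ω)))
      ≤ 1 + ∑ w, (E w).indicator (fun _ => ENNReal.ofReal (wt w)) ω := by
    filter_upwards [hcons] with ω hω
    by_cases h0 : K 0 ω ∈ ι
    · have hmem : ∀ i ≤ n, K (i * h) ω ∈ ι := by
        intro i hi
        rw [mem_massFinset, hω i hi]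
        exact (mem_massFinset hc).1 h0
      set w : Fin (n + 1) → ι := fun i => ⟨K ((i : ℕ) * h) ω, hmem i (by omega)⟩ with hw
      have hp : ∀ i ≤ n, path w i = K (i * h) ω := by
        intro i hi
        simp only [hpath, hw, Fin.val_ofNat, Nat.mod_eq_of_lt (Nat.lt_succ_of_le hi)]
      have hwE : ω ∈ E w := fun i hi => (hp i hi).symm
      have hterm : ENNReal.ofReal (Real.exp
          (∑ i ∈ Finset.range n, h * V (K ((i + 1 : ℕ) * h) ω)))
          = (E w).indicator (fun _ => ENNReal.ofReal (wt w)) ω := by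
        rw [Set.indicator_of_mem hwE, hwt]
        congr 2
        refine Finset.sum_congr rfl fun i hi => ?_
        rw [hp (i + 1) (by rw [Finset.mem_range] at hi; omega)]
      rw [hterm]
      exact (Finset.single_le_sum (f := fun w => (E w).indicator
        (fun _ => ENNReal.ofReal (wt w)) ω) (fun _ _ => zero_le) (Finset.mem_univ w)).trans
        le_add_self
    · have hzero : ∀ i ∈ Finset.range n, h * V (K ((i + 1 : ℕ) * h) ω) = 0 := by
        intro i hi
        rw [Finset.mem_range] at hi
        rw [hV, mul_zero]
        rw [mem_massFinset, hω (i + 1) (by omega)]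
        rwa [mem_massFinset] at h0
      rw [Finset.sum_eq_zero hzero]
      simp
  refine (lintegral_mono_ae hpt).trans ?_
  rw [lintegral_add_left measurable_const, lintegral_const, measure_univ, mul_one,
    lintegral_finsetSum _ fun w _ => measurable_const.indicator (hEmeas w)]
  gcongr
  have hprob : ∀ w, ∫⁻ ω, (E w).indicator (fun _ => ENNReal.ofReal (wt w)) ω ∂P
      = ENNReal.ofReal (μ (w 0).1 * ∏ i : Fin n,
        weightedStep (fun t => Matrix.of fun k l : ι => transition α c t k.1 l.1)
          (fun k => V k.1) h (w i.castSucc) (w i.succ)) := by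
    intro w
    rw [lintegral_indicator_const (hEmeas w), hE,
      hK.finite_dim n (fun i => i * h) (path w) (by simp)
        (fun i j hij => by dsimp only; gcongr) (htimes n le_rfl).2,
      ← ENNReal.ofReal_mul (Real.exp_pos _).le]
    congr 1
    have h1 : ∀ i : Fin n, path w i = (w i.castSucc).1 := by
      intro i
      simp only [hpath]
      congr 2
      ext
      simp
    have h2 : ∀ i : Fin n, path w (i + 1) = (w i.succ).1 := by
      intro i
      simp only [hpath]
      congr 2
      ext
      simp [Nat.mod_eq_of_lt (Nat.succ_lt_succ i.2)]
    have h3 : path w 0 = (w 0).1 := by simp [hpath]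
    rw [Finset.prod_range, h3, Finset.sum_range, Real.exp_sum, mul_left_comm, ← Finset.prod_mul_distrib]
    congr 1
    refine Finset.prod_congr rfl fun i _ => ?_
    rw [h1, h2, weightedStep, Matrix.of_apply, Matrix.of_apply, mul_comm]
    congr 2
    push_cast
    ring
  simp_rw [hprob]
  rw [← ENNReal.ofReal_sum_of_nonneg, sum_paths_eq_pow _ n (fun k : ι => μ k.1)]
  intro w _
  refine mul_nonneg (hμ _) (Finset.prod_nonneg fun i _ => ?_)
  exact mul_nonneg (transition_nonneg hα hc hh0.le _ _) (Real.exp_pos _).le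

/-- Feynman–Kac upper bound through the quadratic form of the perturbed generator. -/
lemma IsRescaledZRP.lintegral_exp_integral_le [IsProbabilityMeasure P] (hα : 1 ≤ α) (hc : 0 < c)
    (ha : 0 < a) (hT : 0 < T) (hK : IsRescaledZRP α c T (equilibrium α c a) P K)
    {m L : ℝ} {V : Config d N → ℝ} (hV : ∀ k ∉ massFinset d N hc m, V k = 0)
    (hL : ∀ f : Config d N → ℝ,
      ∑ k ∈ massFinset d N hc m, equilibrium α c a k * f k * (gen α c f k + V k * f k)
        ≤ L * ∑ k ∈ massFinset d N hc m, equilibrium α c a k * f k ^ 2) :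
    ∫⁻ ω, ENNReal.ofReal (Real.exp (∫ s in (0 : ℝ)..T, V (K s ω))) ∂P
      ≤ 1 + ENNReal.ofReal (Real.exp (T * (L + 1))) := by
  classical
  have hα0 : 0 < α := by linarith
  have hπ := fun k : Config d N => equilibrium_pos hα hc ha k
  obtain ⟨C, hC⟩ : ∃ C, ∀ k, |V k| ≤ C := by
    refine ⟨∑ k ∈ massFinset d N hc m, |V k|, fun k => ?_⟩
    by_cases hk : k ∈ massFinset d N hc m
    · exact Finset.single_le_sum (f := fun k => |V k|) (fun _ _ => abs_nonneg _) hk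
    · rw [hV k hk, abs_zero]
      exact Finset.sum_nonneg fun _ _ => abs_nonneg _
  set I : ℕ → Ω → ENNReal := fun n ω => ENNReal.ofReal (Real.exp
        (∑ i ∈ Finset.range n, T / n * V (K ((i + 1 : ℕ) * (T / n)) ω))) with hI
  have hImeas : ∀ n, Measurable (I n) := by
    intro n
    refine ENNReal.measurable_ofReal.comp (Real.measurable_exp.comp
      (Finset.measurable_sum _ fun i hi => ?_))
    rw [Finset.mem_range] at hi
    have hn' : (0 : ℝ) < n := by exact_mod_cast (by omega : 0 < n)
    refine ((measurable_of_countable V).comp (hK.measurable _ ⟨by positivity, ?_⟩)).const_mul _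
    calc ((i + 1 : ℕ) : ℝ) * (T / n) ≤ n * (T / n) := by
          gcongr
          omega
      _ = T := by field_simp
  have hlim : ∀ᵐ ω ∂P, ENNReal.ofReal (Real.exp (∫ s in (0 : ℝ)..T, V (K s ω)))
      ≤ liminf (fun n => I n ω) atTop := by
    filter_upwards [hK.right_continuous] with ω hω
    have h1 := tendsto_right_riemann_sum hT (fun s => K s ω) V hC hω
    exact (ENNReal.tendsto_ofReal
      ((Real.continuous_exp.tendsto _).comp h1)).liminf_eq.ge
  -- Fatou's lemma passes to the limit without measurability of the time integral in `ω`.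
  refine (lintegral_mono_ae hlim).trans
    ((lintegral_liminf_le' fun n => (hImeas n).aemeasurable).trans ?_)
  set Pm : ℝ → Matrix (massFinset d N hc m) (massFinset d N hc m) ℝ :=
    fun t => Matrix.of fun k l => transition α c t k.1 l.1 with hPm
  have hPexp : ∀ t, Pm t = NormedSpace.exp (t • genMatrix α hc m) := by
    intro t
    ext k l
    exact transition_eq_exp hα0 hc m t k l
  have hev := eventually_sum_weightedStep_pow_le
    (p := fun k : massFinset d N hc m => equilibrium α c a k.1) (fun k => hπ k.1)
    (A := genMatrix α hc m) (P := Pm) (V := fun k => V k.1) (L := L)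
    (by rw [hPexp, zero_smul, NormedSpace.exp_zero])
    (by simp_rw [hPexp]; exact hasDerivAt_exp_smul_apply_zero _)
    (by
      intro f
      set g : Config d N → ℝ := fun k => if hk : k ∈ massFinset d N hc m then f ⟨k, hk⟩ else 0
      have hg : ∀ k : massFinset d N hc m, g k.1 = f k := fun k => by simp [g]
      have h1 := hL g
      rw [← Finset.sum_coe_sort, ← Finset.sum_coe_sort (massFinset d N hc m)] at h1
      simp_rw [gen_eq_mulVec hα0 hc m g, hg] at h1
      exact h1) hT
  refine liminf_le_of_frequently_le' (Eventually.frequently ?_)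
  filter_upwards [hev, eventually_gt_atTop 0] with n hn hn0
  refine (hK.lintegral_exp_riemann_sum_le hα0 hc hT (fun k => (hπ k).le) hV hn0).trans ?_
  gcongr
  refine hn.trans ?_
  refine mul_le_of_le_one_left (Real.exp_pos _).le ?_
  rw [Finset.sum_coe_sort (massFinset d N hc m) (equilibrium α c a)]
  exact hK.sum_initial_le_one hT (fun k => (hπ k).le) _

end ExponentialMoments

/-! ### Uniform exponential bound and conclusion -/

lemma mem_massBounded_iff {d N : ℕ} [NeZero N] {c b : ℝ} (hc : 0 < c) {k : Config d N} :
    k ∈ massBounded c b ↔ k ∈ massFinset d N hc (b * (N : ℝ) ^ d) := by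
  have hN : (0 : ℝ) < (N : ℝ) ^ d := by
    have := NeZero.pos N
    positivity
  rw [mem_massFinset, massBounded, Set.mem_ofPred_eq, one_div, inv_mul_le_iff₀ hN, mul_comm b]

/-- The exponential moment of the time integral of the truncated norm has the order of
`exp (N ^ d / c)`. -/
lemma exists_exp_moment_bound {d : ℕ} (hd : 1 ≤ d) {α b T : ℝ} (hα : 1 ≤ α) (hb : 0 < b)
    (hT : 0 < T) :
    ∃ C : ℝ, ∀ (N : ℕ) [NeZero N] (c a : ℝ), 0 < c → c ≤ 1 → 0 < a →
      ∀ (Ω : Type*) [MeasurableSpace Ω] (P : Measure Ω) [IsProbabilityMeasure P]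
        (K : ℝ → Ω → Config d N), IsRescaledZRP α c T (equilibrium α c a) P K →
        ∫⁻ ω, ENNReal.ofReal (Real.exp ((N : ℝ) ^ d / c * ∫ s in (0 : ℝ)..T,
            truncatedNorm α c b (fun u => |u| ^ youngExponent d α) (K s ω))) ∂P
          ≤ ENNReal.ofReal (Real.exp (C * ((N : ℝ) ^ d / c))) := by
  obtain ⟨C, hC⟩ := exists_perturbed_form_bound hd (by linarith : 0 < α) hb
  -- The final `+ 1` absorbs the additive `1` of the Feynman–Kac bound, since `2 ≤ exp R` for `R = N
  -- ^ d / c ≥ 1`.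
  refine ⟨T * (|C| + 1) + 1, fun N _ c a hc hc1 ha Ω _ P _ K hK => ?_⟩
  have hN : (1 : ℝ) ≤ (N : ℝ) ^ d := one_le_pow₀ (by exact_mod_cast NeZero.pos N)
  have hR : 1 ≤ (N : ℝ) ^ d / c := by
    rw [one_le_div hc]
    linarith
  set R : ℝ := (N : ℝ) ^ d / c with hRdef
  simp_rw [← intervalIntegral.integral_const_mul]
  have hmain := IsRescaledZRP.lintegral_exp_integral_le (m := b * (N : ℝ) ^ d) (L := C * R)
    (V := fun k => R * truncatedNorm α c b (fun u => |u| ^ youngExponent d α) k) hα hc ha hT hK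
    (fun k hk => by simp [truncatedNorm, mem_massBounded_iff hc, hk])
    (fun f => by
      refine le_trans (le_of_eq (Finset.sum_congr rfl fun k hk => ?_)) (hC N c a hc hc1 ha f)
      rw [truncatedNorm, if_pos ((mem_massBounded_iff hc).2 hk)])
  refine hmain.trans ?_
  rw [← ENNReal.ofReal_one, ← ENNReal.ofReal_add zero_le_one (Real.exp_pos _).le]
  refine ENNReal.ofReal_le_ofReal ?_
  have h1 : T * (C * R + 1) ≤ T * (|C| + 1) * R := by
    have h2 : C * R ≤ |C| * R := by
      gcongr
      exact le_abs_self C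
    calc T * (C * R + 1) ≤ T * (|C| * R + R) := by gcongr
      _ = _ := by ring
  have h0 : 0 ≤ T * (|C| + 1) * R := by positivity
  have h3 : 2 ≤ Real.exp R := by
    have := Real.add_one_le_exp R
    linarith
  calc 1 + Real.exp (T * (C * R + 1))
      ≤ Real.exp (T * (|C| + 1) * R) + Real.exp (T * (|C| + 1) * R) := by
        gcongr
        exact Real.one_le_exp h0
    _ = 2 * Real.exp (T * (|C| + 1) * R) := by ring
    _ ≤ Real.exp R * Real.exp (T * (|C| + 1) * R) := by gcongr
    _ = _ := by
      rw [← Real.exp_add]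
      congr 1
      ring

end ZeroRange

end

theorem theorem3 (d : ℕ) (hd : 1 ≤ d) (α : ℝ) (hα : 1 ≤ α)
    (χ : ℕ+ → ℝ) (hχ_pos : ∀ N, 0 < χ N) (hχ : Tendsto χ atTop (𝓝 0)) :
    ∃ β : ℝ, 0 < β ∧ ∃ Φ : ℝ → ℝ, ZeroRange.IsStrictYoung Φ ∧
      ∀ (T a b : ℝ), 0 < T → 0 < a → 0 < b →
      ∀ (Ω : Type*) [MeasurableSpace Ω] (P : Measure Ω) [IsProbabilityMeasure P]
        (K : ∀ N : ℕ+, ℝ → Ω → ZeroRange.Config d N),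
        (∀ N : ℕ+, ZeroRange.IsRescaledZRP α (χ N) T
          (ZeroRange.equilibrium α (χ N) a) P (K N)) →
        limsup (fun N : ℕ+ =>
          ((χ N / (N : ℝ) ^ d : ℝ) : EReal) *
            ENNReal.log (∫⁻ ω, ENNReal.ofReal (Real.exp
              (β * (N : ℝ) ^ d / χ N *
                ∫ s in (0 : ℝ)..T, ZeroRange.truncatedNorm α (χ N) b Φ (K N s ω))) ∂P))
          atTop < ⊤ := by
  have hα0 : 0 < α := by linarith
  refine ⟨1, one_pos, fun u => |u| ^ ZeroRange.youngExponent d α,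
    ZeroRange.isStrictYoung_rpow_abs (ZeroRange.one_lt_youngExponent d hα0), ?_⟩
  intro T a b hT ha hb Ω _ P _ K hK
  obtain ⟨C, hC⟩ := ZeroRange.exists_exp_moment_bound hd hα hb hT
  refine lt_of_le_of_lt (b := (C : EReal)) ?_ (EReal.coe_lt_top C)
  refine limsup_le_of_le (by isBoundedDefault) ?_
  -- The convergence of the particle sizes enters only through `χ N ≤ 1` for large `N`.
  filter_upwards [hχ.eventually_le_const one_pos] with N hN
  have hpos := hχ_pos N
  have hNd : (0 : ℝ) < (N : ℝ) ^ d := by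
    have : (0 : ℝ) < (N : ℕ) := by exact_mod_cast N.pos
    positivity
  have h := hC N (χ N) a hpos hN ha Ω P (K N) (hK N)
  rw [one_mul]
  have hlog := ENNReal.log_le_log h
  rw [ENNReal.log_ofReal_of_pos (Real.exp_pos _), Real.log_exp] at hlog
  refine (mul_le_mul_of_nonneg_left hlog
    (by exact_mod_cast (div_pos hpos hNd).le)).trans (le_of_eq ?_)
  rw [← EReal.coe_mul]
  congr 1
  field_simp
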